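/- **Setting.** Let $n\ge 1$, $m\ge 0$, $N=3n+m$, let $Q\in\mathbb R^{n\times n}$ be symmetric positive semidefinite, $c\in\mathbb R^n$, $A\in\mathbb R^{m\times n}$, $b\in\mathbb R^m$, and let $\mathrm{tol}>0$. For $\omega,\tau>0$ and $z=(x,\lambda,\mu_L,\mu_R)\in\mathbb R^n\times\mathbb R^m\times\mathbb R^n\times\mathbb R^n=\mathbb R^N$ put (products of vectors are componentwise, $e$ is the vector of ones) $$F_\tau(z)=\begin{pmatrix}Qx+\omega x+c-A^{\mathsf T}\lambda-\mu_L+\mu_R\\ Ax-b+\omega\lambda\\ \mu_L(e+x)-\tau e\\ \mu_R(e-x)-\tau e\end{pmatrix},\qquad DF(z)=\begin{bmatrix}Q+\omega I&-A^{\mathsf T}&-I&I\\A&\omega I&0&0\\ \operatorname{diag}(\mu_L)&0&\operatorname{diag}(e+x)&0\\-\operatorname{diag}(\mu_R)&0&0&\operatorname{diag}(e-x)\end{bmatrix}.$$ **Parameters.** Fix positive numbers with $\theta\le 0.3$, $\beta\le\theta$, $1-\beta/\sqrt{2n}\le\sigma<1$, $C_q\ge\|Q\|_2n+\|c\|_2\sqrt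 n$, $\omega\le\min\{\frac{\mathrm{tol}}{2n},\frac{\mathrm{tol}^2}{16(4C_q+n)},1\}$, $C_\lambda\ge(\|A\|_2\sqrt n+\|b\|_2)/\omega$, $C_{\Delta\mu}\ge(\omega+\|Q\|_2)\sqrt n+\|c\|_2+\|A^{\mathsf T}\|_2C_\lambda$, $\tau_A\ge\max\{\frac14\|Q+\omega I+\frac1\omega A^{\mathsf T}A\|_2,\;4\|c-\frac1\omega A^{\mathsf T}b\|_2\}$, $\tau_E\le\frac{\mathrm{tol}^2\omega}{48n\max\{\|A\|_2,C_q\}}$, $C_\mu\ge\sqrt{2n}\,(C_{\Delta\mu}+(1+\theta)\tau_A)$, $C_z\ge\sqrt{n+C_\lambda^2+C_\mu^2}+0.1$, $C_{gap}\le\frac{1-\theta}{1+C_z}\cdot\frac{\sigma\tau_E}{2}$, $C_{DF}\ge\|Q\|_2+2\omega+2\|A\|_F+4+4C_z$, $C_{DFinv}\ge\frac1{C_{gap}}\max\{\frac1\omega,\frac{C_z}{C_{gap}}\}$, $\kappa_{DF}\ge C_{DF}C_{DFinv}$, $C_{\delta F}\ge C_{DF}$, $C_{\delta DF}\ge2$,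 $C_{\delta\Delta z}\ge2\kappa_{DF}$, $C_\nu\ge\max\{2C_{\delta\Delta z}(C_{\delta F}C_{DFinv}+\frac2\omega C_{\delta DF}C_z),\;1+C_{DFinv}C_{\delta F}\}$, $\nu_2\le\min\{0.1,\frac{C_{gap}}{C_\nu},\frac{\omega}{2C_{\delta DF}\kappa_{DF}},\frac{\theta\sigma\tau_E}{2C_\nu C_{\delta F}}\}$, $\nu_1\le\nu_2/C_\nu$, $\nu_0\le\min\{\nu_1/C_\nu,\frac{\mathrm{tol}}{2\max\{\|A\|_2,C_q\}}\}$. **Neighbourhoods.** $\mathcal N(\tau)$ is the set of all $z$ with $\|x\|_\infty<1$, $\mu_L,\mu_R>0$ and $F_\tau(z)=(0,0,r^{3},r^{4})$ where $\|(r^{3},r^{4})\|_2\le\theta\tau$; $\mathcal N_h(\tau)$ is the same with $\frac12\theta\tau$ in place of $\theta\tau$. $\mathcal N(\tau,\nu)$ and $\mathcal N_h(\tau,\nu)$ are the sets of points at Euclidean distance at most $\nu$ from some point of $\mathcal N(\tau)$, resp. $\mathcal N_h(\tau)$. **Computation.** Floating-point arithmetic with unit roundoff $\varepsilon_{mach}$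 follows the standard model (no over- or underflow): the problem data are stored, and the result of each elementary operation is returned, with relative error at most $\varepsilon_{mach}$; sums may be evaluated in any order. A linear solver is stable with constant $K$ if, for every regular $G$ with $K\varepsilon_{mach}\|G\|_2\|G^{-1}\|_2<1$ and every $v$, its output $u$ for $Gu=v$ satisfies $\|u-w\|_2\le K\varepsilon_{mach}\|w\|_2$ for some $w$ with $(G+\delta G)w=v+\delta v$, $\|\delta G\|_2\le K\varepsilon_{mach}\|G\|_2$, $\|\delta v\|_2\le K\varepsilon_{mach}\|v\|_2$. **Theorem (Error-reset step).** Let $\tilde z\in\mathcal N_h(\hat\tau,\nu_2)$ with $\hat\tau\in[\sigma\tau_E,\tau_A]$, let $(\tilde r^1,\tilde r^2,\tilde r^3,\tilde r^4):=F_{\hat\tau}(\tilde z)$, and consider $$DF(\tilde z)\,\Delta\tilde z=-(\tilde r^1,\tilde r^2,0,0),\qquad \hat{\tilde z}:=\tilde z+\Delta\tilde z.$$ 1. For all $n$, $m$ and $K\ge0$ there is a constant $C>0$, depending on nothing else, such that if the residual blocks $\tilde r^1,\tilde r^2$, the matrix $DF(\tilde z)$, the solution $\Delta\tilde z$ and the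 sum $\tilde z+\Delta\tilde z$ are computed in floating-point arithmetic with unit roundoff $\varepsilon_{mach}>0$ and a linear solver that is stable with constant $K$, and $$C\,\varepsilon_{mach}\le\frac{\nu_0}{4\,C_z\,\kappa_{DF}},$$ then the computed vector satisfies $\hat{\tilde z}\in\mathcal N(\hat\tau,\nu_0)$. 2. In exact arithmetic, $DF(\tilde z)$ is regular and $\hat{\tilde z}\in\mathcal N(\hat\tau)$. -/

import Mathlib

noncomputable section

open scoped Matrix Matrix.Norms.L2Operator

namespace StableIPM

/-- The Euclidean norm of a real vector. (For matrices, `‖·‖` below is the spectral norm.) -/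
def norm2 {ι : Type} [Fintype ι] (v : ι → ℝ) : ℝ := ‖WithLp.toLp 2 v‖

/-- The Frobenius norm of a real matrix. -/
def normF {m n : ℕ} (A : Matrix (Fin m) (Fin n) ℝ) : ℝ := √(∑ i, ∑ j, A i j ^ 2)

/-- Data of the problem: minimise `xᵀQx/2 + cᵀx` over the `x` with `‖x‖_∞ ≤ 1` that minimise
`‖A x - b‖₂` there. -/
structure BoxQP (n m : ℕ) where
  Q : Matrix (Fin n) (Fin n) ℝ
  c : Fin n → ℝ
  A : Matrix (Fin m) (Fin n) ℝ
  b : Fin m → ℝ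
  Q_psd : Q.PosSemidef

/-- Coordinates of primal-dual vectors `z = (x, lam, μL, μR)`. -/
abbrev Idx (n m : ℕ) : Type := Fin n ⊕ (Fin m ⊕ (Fin n ⊕ Fin n))

/-- Primal-dual vectors, i.e. `ℝ^N` with `N = 3 n + m`. -/
abbrev PD (n m : ℕ) : Type := Idx n m → ℝ

section Blocks

variable {n m : ℕ}

def PD.x (z : PD n m) : Fin n → ℝ := fun i => z (Sum.inl i)
def PD.lam (z : PD n m) : Fin m → ℝ := fun i => z (Sum.inr (Sum.inl i))
def PD.muL (z : PD n m) : Fin n → ℝ := fun i => z (Sum.inr (Sum.inr (Sum.inl i)))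
def PD.muR (z : PD n m) : Fin n → ℝ := fun i => z (Sum.inr (Sum.inr (Sum.inr i)))

/-- The primal-dual vector with the given blocks. -/
def PD.mk (u₁ : Fin n → ℝ) (u₂ : Fin m → ℝ) (u₃ u₄ : Fin n → ℝ) : PD n m :=
  Sum.elim u₁ (Sum.elim u₂ (Sum.elim u₃ u₄))

/-- The four blocks of the optimality function `F_τ`. -/
def res1 (P : BoxQP n m) (ω : ℝ) (z : PD n m) : Fin n → ℝ :=
  P.Q *ᵥ z.x + ω • z.x + P.c - P.Aᵀ *ᵥ z.lam - z.muL + z.muR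

def res2 (P : BoxQP n m) (ω : ℝ) (z : PD n m) : Fin m → ℝ :=
  P.A *ᵥ z.x - P.b + ω • z.lam

def res3 (τ : ℝ) (z : PD n m) : Fin n → ℝ := fun j => z.muL j * (1 + z.x j) - τ

def res4 (τ : ℝ) (z : PD n m) : Fin n → ℝ := fun j => z.muR j * (1 - z.x j) - τ

/-- The optimality function `F_τ`. -/
def optF (P : BoxQP n m) (ω τ : ℝ) (z : PD n m) : PD n m :=
  PD.mk (res1 P ω z) (res2 P ω z) (res3 τ z) (res4 τ z)

/-- The Jacobian `DF(z)` of `F_τ`, as a function of the matrices `Q`, `A` (it does not depend on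
`c`, `b`, `τ`). -/
def jacF (Q : Matrix (Fin n) (Fin n) ℝ) (A : Matrix (Fin m) (Fin n) ℝ) (ω : ℝ) (z : PD n m) :
    Matrix (Idx n m) (Idx n m) ℝ :=
  Matrix.fromBlocks
    (Q + ω • (1 : Matrix (Fin n) (Fin n) ℝ))
    (Matrix.fromCols (-Aᵀ) (Matrix.fromCols (-1) 1))
    (Matrix.fromRows A (Matrix.fromRows (Matrix.diagonal z.muL) (-Matrix.diagonal z.muR)))
    (Matrix.fromBlocks (ω • 1) 0 0
      (Matrix.fromBlocks (Matrix.diagonal (1 + z.x)) 0 0 (Matrix.diagonal (1 - z.x))))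

/-- The neighbourhood of width `w` of the central path: `F_τ(z) = (0, 0, r₃, r₄)` with
`‖(r₃, r₄)‖₂ ≤ w τ`, and `‖x‖_∞ < 1`, `μL, μR > 0`. -/
def nbhd (P : BoxQP n m) (ω w τ : ℝ) : Set (PD n m) :=
  {z | ∃ r₃ r₄ : Fin n → ℝ, optF P ω τ z = PD.mk 0 0 r₃ r₄ ∧
      norm2 (Sum.elim r₃ r₄) ≤ w * τ ∧
      ‖z.x‖ < 1 ∧ (∀ j, 0 < z.muL j) ∧ (∀ j, 0 < z.muR j)}

/-- The closed envelope of radius `ν` around a set of primal-dual vectors. -/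
def envelope (S : Set (PD n m)) (ν : ℝ) : Set (PD n m) :=
  {z' | ∃ z ∈ S, norm2 (z' - z) ≤ ν}

end Blocks

/-- The method parameters on which the path-following depends. -/
structure Params where
  θ : ℝ
  β : ℝ
  σ : ℝ
  Cq : ℝ
  ω : ℝ
  Clam : ℝ
  CΔμ : ℝ
  τA : ℝ
  τE : ℝ
  Cμ : ℝ
  Cz : ℝ
  Cgap : ℝ
  CDF : ℝ
  CDFinv : ℝ
  κDF : ℝ
  CδF : ℝ
  CδDF : ℝ
  CδΔz : ℝ
  Cν : ℝ
  ν₂ : ℝ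
  ν₁ : ℝ
  ν₀ : ℝ

/-- The rules by which the (positive) method parameters are computed from the problem data and the
tolerance. An inequality stands for an assignment that may be rounded in that direction. -/
structure Params.Admissible (p : Params) {n m : ℕ} (P : BoxQP n m) (tol : ℝ) : Prop where
  θ_pos : 0 < p.θ
  θ_le : p.θ ≤ 0.3
  β_pos : 0 < p.β
  β_le : p.β ≤ p.θ
  σ_ge : 1 - p.β / √(2 * n) ≤ p.σ
  σ_lt : p.σ < 1
  Cq_pos : 0 < p.Cq
  Cq_ge : ‖P.Q‖ * n + norm2 P.c * √n ≤ p.Cq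
  ω_pos : 0 < p.ω
  ω_le : p.ω ≤ min (tol / (2 * n)) (min (tol ^ 2 / (4 * p.Cq + n) * (1 / 16)) 1)
  Clam_pos : 0 < p.Clam
  Clam_ge : (‖P.A‖ * √n + norm2 P.b) / p.ω ≤ p.Clam
  CΔμ_pos : 0 < p.CΔμ
  CΔμ_ge : (p.ω + ‖P.Q‖) * √n + norm2 P.c + ‖P.Aᵀ‖ * p.Clam ≤ p.CΔμ
  τA_pos : 0 < p.τA
  τA_ge : max (‖P.Q + p.ω • (1 : Matrix (Fin n) (Fin n) ℝ) + (1 / p.ω) • (P.Aᵀ * P.A)‖ / 4)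
      (4 * norm2 (P.c - (1 / p.ω) • (P.Aᵀ *ᵥ P.b))) ≤ p.τA
  τE_pos : 0 < p.τE
  τE_le : p.τE ≤ tol ^ 2 * p.ω / (48 * n * max ‖P.A‖ p.Cq)
  Cμ_pos : 0 < p.Cμ
  Cμ_ge : √(2 * n) * (p.CΔμ + (1 + p.θ) * p.τA) ≤ p.Cμ
  Cz_pos : 0 < p.Cz
  Cz_ge : √(n + p.Clam ^ 2 + p.Cμ ^ 2) + 0.1 ≤ p.Cz
  Cgap_pos : 0 < p.Cgap
  Cgap_le : p.Cgap ≤ (1 - p.θ) / (1 + p.Cz) * p.σ * p.τE * (1 / 2)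
  CDF_pos : 0 < p.CDF
  CDF_ge : ‖P.Q‖ + 2 * p.ω + 2 * normF P.A + 4 + 4 * p.Cz ≤ p.CDF
  CDFinv_pos : 0 < p.CDFinv
  CDFinv_ge : 1 / p.Cgap * max (1 / p.ω) (p.Cz / p.Cgap) ≤ p.CDFinv
  κDF_pos : 0 < p.κDF
  κDF_ge : p.CDF * p.CDFinv ≤ p.κDF
  CδF_pos : 0 < p.CδF
  CδF_ge : p.CDF ≤ p.CδF
  CδDF_ge : 2 ≤ p.CδDF
  CδΔz_pos : 0 < p.CδΔz
  CδΔz_ge : 2 * p.κDF ≤ p.CδΔz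
  Cν_pos : 0 < p.Cν
  Cν_ge : max (2 * p.CδΔz * (p.CδF * p.CDFinv + 2 / p.ω * p.CδDF * p.Cz))
      (1 + p.CDFinv * p.CδF) ≤ p.Cν
  ν₂_pos : 0 < p.ν₂
  ν₂_le : p.ν₂ ≤ min 0.1 (min (p.Cgap / p.Cν) (min (p.ω / (2 * p.CδDF * p.κDF))
      (p.θ * p.σ * p.τE / (2 * p.Cν * p.CδF))))
  ν₁_pos : 0 < p.ν₁
  ν₁_le : p.ν₁ ≤ p.ν₂ / p.Cν
  ν₀_pos : 0 < p.ν₀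
  ν₀_le : p.ν₀ ≤ min (p.ν₁ / p.Cν) (tol / (2 * max ‖P.A‖ p.Cq))

section Spaces

variable {n m : ℕ}

/-- `𝒩(τ)`. -/
def spaceN (P : BoxQP n m) (p : Params) (τ : ℝ) : Set (PD n m) := nbhd P p.ω p.θ τ

/-- `𝒩_h(τ)`, of half the width. -/
def spaceNh (P : BoxQP n m) (p : Params) (τ : ℝ) : Set (PD n m) := nbhd P p.ω (0.5 * p.θ) τ

/-- `𝒩(τ, ν)`. -/
def spaceNenv (P : BoxQP n m) (p : Params) (τ ν : ℝ) : Set (PD n m) := envelope (spaceN P p τ) ν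

/-- `𝒩_h(τ, ν)`. -/
def spaceNhenv (P : BoxQP n m) (p : Params) (τ ν : ℝ) : Set (PD n m) := envelope (spaceNh P p τ) ν

/-- The coefficient matrix of the Newton system for the exact data. -/
def jac (P : BoxQP n m) (p : Params) (z : PD n m) : Matrix (Idx n m) (Idx n m) ℝ :=
  jacF P.Q P.A p.ω z

/-- The right-hand side `-(r¹, r², 0, 0)` of the error-reset step, where
`(r¹, r², r³, r⁴) = F_τ(z)`. -/
def resetRhs (P : BoxQP n m) (p : Params) (τ : ℝ) (z : PD n m) : PD n m :=
  -PD.mk (optF P p.ω τ z).x (optF P p.ω τ z).lam 0 0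

end Spaces

/-- The standard model of floating-point arithmetic with unit roundoff `ε` (no over- or underflow):
`y` is a possible machine result for a number whose exact value is `x`, i.e. `y = x (1 + δ)` with
`|δ| ≤ ε`. -/
def Rounds (ε x y : ℝ) : Prop := |y - x| ≤ ε * |x|

/-- `FloatSum ε s y`: `y` is a possible machine result of summing the numbers in the non-empty
multiset `s`, in any order and with any bracketing, each addition being rounded. -/
inductive FloatSum (ε : ℝ) : Multiset ℝ → ℝ → Prop
  | single (a : ℝ) : FloatSum ε {a} a
  | add {s t : Multiset ℝ} {a b y : ℝ} (hs : FloatSum ε s a) (ht : FloatSum ε t b)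
      (hy : Rounds ε (a + b) y) : FloatSum ε (s + t) y

/-- `u` is an output for the linear system `G u = v` that complies with (mixed forward-backward)
numerical stability with constant `K` at unit roundoff `ε`: unless the matrix is singular or
numerically singular, `u` is close to the exact solution `w` of a nearby system. Backward stability
is the case `w = u`. -/
def StablySolves {ι : Type} [Fintype ι] [DecidableEq ι] (K ε : ℝ)
    (G : Matrix ι ι ℝ) (v u : ι → ℝ) : Prop :=
  IsUnit G.det → K * ε * (‖G‖ * ‖G⁻¹‖) < 1 →
    ∃ (δG : Matrix ι ι ℝ) (δv w : ι → ℝ),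
      ‖δG‖ ≤ K * ε * ‖G‖ ∧ norm2 δv ≤ K * ε * norm2 v ∧
      (G + δG) *ᵥ w = v + δv ∧ norm2 (u - w) ≤ K * ε * norm2 w

/-- `z'` is a possible machine result of the error-reset step from `z`, with unit roundoff `ε` and a
stable linear solver with constant `K`. -/
structure FloatResetStep {n m : ℕ} (P : BoxQP n m) (p : Params) (K ε : ℝ) (z z' : PD n m) where
  /-- the problem data as stored in the machine -/
  Q : Matrix (Fin n) (Fin n) ℝ
  c : Fin n → ℝ
  A : Matrix (Fin m) (Fin n) ℝ
  b : Fin m → ℝ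
  Q_rounds : ∀ i j, Rounds ε (P.Q i j) (Q i j)
  c_rounds : ∀ i, Rounds ε (P.c i) (c i)
  A_rounds : ∀ i j, Rounds ε (P.A i j) (A i j)
  b_rounds : ∀ i, Rounds ε (P.b i) (b i)
  /-- the computed products `Q i j * x j`, `A i j * x j`, `A i j * lam i`, `ω * x i`, `ω * lam i` -/
  Qx : Matrix (Fin n) (Fin n) ℝ
  Ax : Matrix (Fin m) (Fin n) ℝ
  Alam : Matrix (Fin m) (Fin n) ℝ
  ωx : Fin n → ℝ
  ωlam : Fin m → ℝ
  Qx_rounds : ∀ i j, Rounds ε (Q i j * z.x j) (Qx i j)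
  Ax_rounds : ∀ i j, Rounds ε (A i j * z.x j) (Ax i j)
  Alam_rounds : ∀ i j, Rounds ε (A i j * z.lam i) (Alam i j)
  ωx_rounds : ∀ i, Rounds ε (p.ω * z.x i) (ωx i)
  ωlam_rounds : ∀ i, Rounds ε (p.ω * z.lam i) (ωlam i)
  /-- the computed residual blocks -/
  r₁ : Fin n → ℝ
  r₂ : Fin m → ℝ
  r₁_sum : ∀ j, FloatSum ε
    (Finset.univ.val.map (fun k => Qx j k) + Finset.univ.val.map (fun i => -Alam i j) +
      {ωx j, c j, -z.muL j, z.muR j}) (r₁ j)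
  r₂_sum : ∀ i, FloatSum ε
    (Finset.univ.val.map (fun k => Ax i k) + {-b i, ωlam i}) (r₂ i)
  /-- the computed Jacobian (every entry takes at most one operation) -/
  G : Matrix (Idx n m) (Idx n m) ℝ
  G_rounds : ∀ k l, Rounds ε (jacF Q A p.ω z k l) (G k l)
  /-- the computed solution of the linear system -/
  Δ : PD n m
  Δ_solves : StablySolves K ε G (-PD.mk r₁ r₂ 0 0) Δ
  /-- the computed update -/
  update : ∀ k, Rounds ε (z k + Δ k) (z' k)

end StableIPM

end

noncomputable section

open scoped Matrix Matrix.Norms.L2Operator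

namespace StableIPM

/-! ### The Euclidean norm -/

section Norm2

variable {ι κ : Type} [Fintype ι] [Fintype κ]

/-! The first two blocks of `F_τ` are affine, so one Newton step aimed at them annihilates them
exactly. It remains to show that the step is too short to spoil the complementarity blocks and the
signs, and that rounding moves the result by at most `ν₀`.

Take `z₀` in the half-width neighbourhood within `ν₂` of the start. At `z₀` the affine blocks
vanish, so the Lipschitz bound `norm2_optF_sub_le` makes the right-hand side at most `CδF ν₂`. The
energy estimate `norm2_le_mul_norm2_jacF_mulVec` bounds the inverse Jacobian by `CDFinv`. Hence the
new point is within `(1 + CDFinv CδF) ν₂ ≤ Cν ν₂` of `z₀`. This is at most `Cgap`, whereas the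
multipliers and slacks at `z₀` are at least `2 Cgap` (`gap_of_mem_spaceN`), so strict feasibility
survives. By the Lipschitz bound once more, the complementarity residual grows by at most `θ τ / 2`,
exactly what the half width left free (`reset_mem_spaceN`).

In floating point, the exact result of the step serves as the nearby point of the neighbourhood.
Rounding the residual, the Jacobian, the solution and the update each contributes at most a multiple
of `s = κDF Cz ε`, with a factor depending only on `n`, `m`, `K`. The assumption on `ε` bounds the
sum of these contributions by `ν₀ / 4`. The transfer through the linear system is
`StablySolves.norm2_sub_le`, a perturbation argument that needs only a lower bound for the exact
Jacobian. -/

theorem norm2_nonneg (v : ι → ℝ) : 0 ≤ norm2 v := norm_nonneg _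

theorem norm2_eq_sqrt (v : ι → ℝ) : norm2 v = √(∑ i, v i ^ 2) := by
  simp [norm2, EuclideanSpace.norm_eq]

theorem norm2_sq (v : ι → ℝ) : norm2 v ^ 2 = ∑ i, v i ^ 2 := by
  rw [norm2_eq_sqrt, Real.sq_sqrt (Finset.sum_nonneg fun i _ => sq_nonneg _)]

theorem norm2_add_le (v w : ι → ℝ) : norm2 (v + w) ≤ norm2 v + norm2 w := by
  simpa [norm2] using norm_add_le (WithLp.toLp 2 v) (WithLp.toLp 2 w)

theorem norm2_neg (v : ι → ℝ) : norm2 (-v) = norm2 v := by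
  simp [norm2]

theorem norm2_sub_le (v w : ι → ℝ) : norm2 (v - w) ≤ norm2 v + norm2 w := by
  simpa [sub_eq_add_neg, norm2_neg] using norm2_add_le v (-w)

theorem norm2_smul (a : ℝ) (v : ι → ℝ) : norm2 (a • v) = |a| * norm2 v := by
  simp [norm2, norm_smul]

theorem abs_le_norm2 (v : ι → ℝ) (i : ι) : |v i| ≤ norm2 v := by
  rw [norm2_eq_sqrt]
  exact Real.abs_le_sqrt (Finset.single_le_sum (f := fun i => v i ^ 2)
    (fun j _ => sq_nonneg _) (Finset.mem_univ i))

theorem norm2_le_mul_of_abs_le {v w : ι → ℝ} {a : ℝ} (ha : 0 ≤ a)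
    (h : ∀ i, |v i| ≤ a * |w i|) : norm2 v ≤ a * norm2 w := by
  refine abs_le_of_sq_le_sq' ?_ (mul_nonneg ha (norm2_nonneg w)) |>.2
  rw [mul_pow, norm2_sq, norm2_sq, Finset.mul_sum]
  refine Finset.sum_le_sum fun i _ => ?_
  have := pow_le_pow_left₀ (abs_nonneg _) (h i) 2
  rwa [mul_pow, sq_abs, sq_abs] at this

theorem norm2_mono {v w : ι → ℝ} (h : ∀ i, |v i| ≤ |w i|) : norm2 v ≤ norm2 w := by
  simpa using norm2_le_mul_of_abs_le zero_le_one (by simpa using h)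

theorem norm2_le_sqrt_card_mul {v : ι → ℝ} {a : ℝ} (ha : 0 ≤ a) (h : ∀ i, |v i| ≤ a) :
    norm2 v ≤ √(Fintype.card ι) * a := by
  have h1 := norm2_le_mul_of_abs_le (w := fun _ => 1) ha (by simpa using h)
  have h2 : norm2 (fun _ : ι => (1 : ℝ)) = √(Fintype.card ι) := by simp [norm2_eq_sqrt]
  rw [h2] at h1
  linarith

theorem norm2_le_card_mul {v : ι → ℝ} {a : ℝ} (ha : 0 ≤ a) (h : ∀ i, |v i| ≤ a) :
    norm2 v ≤ Fintype.card ι * a := by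
  refine (norm2_le_sqrt_card_mul ha h).trans (mul_le_mul_of_nonneg_right ?_ ha)
  rcases Nat.eq_zero_or_pos (Fintype.card ι) with h0 | h0
  · simp [h0]
  · refine Real.sqrt_le_iff.2 ⟨by positivity, ?_⟩
    have : (1 : ℝ) ≤ Fintype.card ι := by exact_mod_cast h0
    nlinarith

theorem sum_mul_le_norm2_mul (v w : ι → ℝ) : ∑ i, v i * w i ≤ norm2 v * norm2 w := by
  rw [norm2_eq_sqrt, norm2_eq_sqrt]
  exact Real.sum_mul_le_sqrt_mul_sqrt _ _ _

theorem norm2_sumElim_sq (v : ι → ℝ) (w : κ → ℝ) :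
    norm2 (Sum.elim v w) ^ 2 = norm2 v ^ 2 + norm2 w ^ 2 := by
  simp [norm2_sq]

theorem eq_zero_of_norm2_le_zero {v : ι → ℝ} (h : norm2 v ≤ 0) : v = 0 := by
  ext i
  exact abs_nonpos_iff.1 ((abs_le_norm2 v i).trans h)

end Norm2

/-! ### Matrices -/

section MatrixNorm

variable {ι κ : Type} [Fintype ι] [Fintype κ]

theorem norm2_mulVec_le [DecidableEq κ] (M : Matrix ι κ ℝ) (v : κ → ℝ) :
    norm2 (M *ᵥ v) ≤ ‖M‖ * norm2 v :=
  Matrix.l2_opNorm_mulVec M (WithLp.toLp 2 v)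

theorem l2_opNorm_le_of_mulVec [DecidableEq κ] {M : Matrix ι κ ℝ} {a : ℝ} (ha : 0 ≤ a)
    (h : ∀ v, norm2 (M *ᵥ v) ≤ a * norm2 v) : ‖M‖ ≤ a := by
  rw [Matrix.l2_opNorm_def]
  exact ContinuousLinearMap.opNorm_le_bound _ ha fun v => h v.ofLp

theorem abs_entry_le_l2_opNorm [DecidableEq κ] (M : Matrix ι κ ℝ) (i : ι) (j : κ) :
    |M i j| ≤ ‖M‖ := by
  have h1 := norm2_mulVec_le M (Pi.single j 1)
  have h2 := abs_le_norm2 (M *ᵥ Pi.single j 1) i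
  have h3 : norm2 (Pi.single j (1 : ℝ)) = 1 := by
    simp [norm2_eq_sqrt, Pi.single_apply]
  rw [h3, mul_one] at h1
  simpa using h2.trans h1

/-- Turns entrywise rounding errors into spectral ones. The loss of dimension factors is harmless,
since the final constant may depend on `n` and `m`. -/
theorem l2_opNorm_le_of_abs_le [DecidableEq κ] {M : Matrix ι κ ℝ} {a : ℝ} (ha : 0 ≤ a)
    (h : ∀ i j, |M i j| ≤ a) : ‖M‖ ≤ Fintype.card ι * (Fintype.card κ * a) := by
  refine l2_opNorm_le_of_mulVec (by positivity) fun v => ?_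
  have hv := norm2_nonneg v
  rw [mul_assoc]
  refine norm2_le_card_mul (by positivity) fun i => ?_
  calc |(M *ᵥ v) i| ≤ ∑ j, |M i j * v j| := Finset.abs_sum_le_sum_abs _ _
    _ ≤ ∑ _j : κ, a * norm2 v := Finset.sum_le_sum fun j _ => by
        rw [abs_mul]
        exact mul_le_mul (h i j) (abs_le_norm2 v j) (abs_nonneg _) ha
    _ = Fintype.card κ * a * norm2 v := by simp [mul_assoc]

theorem normF_nonneg {m n : ℕ} (A : Matrix (Fin m) (Fin n) ℝ) : 0 ≤ normF A := Real.sqrt_nonneg _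

theorem normF_sq {m n : ℕ} (A : Matrix (Fin m) (Fin n) ℝ) :
    normF A ^ 2 = ∑ i, ∑ j, A i j ^ 2 :=
  Real.sq_sqrt (Finset.sum_nonneg fun _ _ => Finset.sum_nonneg fun _ _ => sq_nonneg _)

theorem normF_transpose {m n : ℕ} (A : Matrix (Fin m) (Fin n) ℝ) : normF Aᵀ = normF A := by
  unfold normF
  rw [Finset.sum_comm]
  rfl

theorem norm2_mulVec_le_normF {m n : ℕ} (A : Matrix (Fin m) (Fin n) ℝ) (v : Fin n → ℝ) :
    norm2 (A *ᵥ v) ≤ normF A * norm2 v := by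
  refine abs_le_of_sq_le_sq' ?_ (mul_nonneg (normF_nonneg A) (norm2_nonneg v)) |>.2
  rw [mul_pow, norm2_sq, norm2_sq, normF_sq, Finset.sum_mul]
  exact Finset.sum_le_sum fun i _ =>
    Finset.sum_mul_sq_le_sq_mul_sq Finset.univ (fun j => A i j) v

theorem abs_entry_le_normF {m n : ℕ} (A : Matrix (Fin m) (Fin n) ℝ) (i : Fin m) (j : Fin n) :
    |A i j| ≤ normF A := by
  refine Real.abs_le_sqrt ?_
  calc A i j ^ 2 ≤ ∑ j, A i j ^ 2 := Finset.single_le_sum (f := fun j => A i j ^ 2)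
        (fun _ _ => sq_nonneg _) (Finset.mem_univ j)
    _ ≤ _ := Finset.single_le_sum (f := fun i => ∑ j, A i j ^ 2)
        (fun _ _ => Finset.sum_nonneg fun _ _ => sq_nonneg _) (Finset.mem_univ i)

variable [DecidableEq ι]

/-- A lower bound `‖v‖ ≤ R ‖M v‖` forces a trivial kernel. Regularity and conditioning are carried
in this form because it survives perturbation of `M` without mention of an inverse. -/
theorem isUnit_det_of_norm2_le {M : Matrix ι ι ℝ} {R : ℝ}
    (h : ∀ v, norm2 v ≤ R * norm2 (M *ᵥ v)) : IsUnit M.det := by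
  rw [← Matrix.isUnit_iff_isUnit_det, ← Matrix.mulVec_injective_iff_isUnit]
  intro v w hvw
  have h1 := h (v - w)
  rw [Matrix.mulVec_sub, show M *ᵥ v = M *ᵥ w from hvw, sub_self] at h1
  have h2 : norm2 (0 : ι → ℝ) = 0 := by simp [norm2]
  exact sub_eq_zero.1 (eq_zero_of_norm2_le_zero (by simpa [h2] using h1))

theorem l2_opNorm_inv_le {M : Matrix ι ι ℝ} {R : ℝ} (hR : 0 ≤ R)
    (h : ∀ v, norm2 v ≤ R * norm2 (M *ᵥ v)) : ‖M⁻¹‖ ≤ R := by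
  refine l2_opNorm_le_of_mulVec hR fun v => ?_
  have h1 := h (M⁻¹ *ᵥ v)
  rwa [Matrix.mulVec_mulVec, Matrix.mul_nonsing_inv _ (isUnit_det_of_norm2_le h),
    Matrix.one_mulVec] at h1

/-- Forward error of a stable linear solver applied to a perturbed system. -/
theorem StablySolves.norm2_sub_le {K ε R η g ρ : ℝ} {D G : Matrix ι ι ℝ} {v₀ v Δ u : ι → ℝ}
    (hsol : StablySolves K ε G v u) (hR : 0 ≤ R) (hKε : 0 ≤ K * ε) (hKε1 : K * ε ≤ 1)
    (hD : ∀ v, norm2 v ≤ R * norm2 (D *ᵥ v)) (hη : ‖G - D‖ ≤ η) (hg : ‖G‖ ≤ g)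
    (hsmall : R * (η + K * ε * g) ≤ 1 / 2) (hreg : K * ε * (g * (2 * R)) < 1)
    (hΔ : D *ᵥ Δ = v₀) (hv : norm2 (v - v₀) ≤ ρ) :
    norm2 (u - Δ) ≤
      4 * R * (2 * ρ + K * ε * norm2 v₀ + (η + K * ε * g) * norm2 Δ) + K * ε * norm2 Δ := by
  have hg0 : 0 ≤ g := (norm_nonneg _).trans hg
  have hη0 : 0 ≤ η := (norm_nonneg _).trans hη
  -- Since `R η ≤ 1/2`, the perturbation `G - D` costs at most half of `‖v‖`, so the lower bound
  -- passes to `G` with `2 R`. This supplies both premises of the stability property.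
  have hG : ∀ v, norm2 v ≤ 2 * R * norm2 (G *ᵥ v) := by
    intro v
    have h1 := hD v
    have h2 : D *ᵥ v = G *ᵥ v - (G - D) *ᵥ v := by simp [Matrix.sub_mulVec]
    have h3 := StableIPM.norm2_sub_le (G *ᵥ v) ((G - D) *ᵥ v)
    rw [← h2] at h3
    have h4 := (norm2_mulVec_le (G - D) v).trans
      (mul_le_mul_of_nonneg_right hη (norm2_nonneg v))
    have h5 : R * (η * norm2 v) ≤ 1 / 2 * norm2 v := by
      have : R * η ≤ 1 / 2 := by nlinarith [mul_nonneg hR (mul_nonneg hKε hg0)]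
      nlinarith [norm2_nonneg v]
    have h6 := mul_le_mul_of_nonneg_left (h3.trans (add_le_add_right h4 _)) hR
    linarith
  have hcond : K * ε * (‖G‖ * ‖G⁻¹‖) < 1 :=
    (mul_le_mul_of_nonneg_left (mul_le_mul hg (l2_opNorm_inv_le (by positivity) hG)
      (norm_nonneg _) hg0) hKε).trans_lt hreg
  obtain ⟨δG, δv, w, hδG, hδv, hw, huw⟩ := hsol (isUnit_det_of_norm2_le hG) hcond
  have hρ : 0 ≤ ρ := (norm2_nonneg _).trans hv
  set q := η + K * ε * g with hq
  have hq0 : 0 ≤ q := by positivity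
  -- All perturbations are moved to the right-hand side, so that only the lower bound for the exact
  -- matrix `D` is needed.
  have hdiff : D *ᵥ (w - Δ) = ((v - v₀) + δv) - ((G - D) *ᵥ w + δG *ᵥ w) := by
    rw [Matrix.mulVec_sub, hΔ, Matrix.sub_mulVec]
    rw [Matrix.add_mulVec] at hw
    rw [show v - v₀ + δv = (v + δv) - v₀ by abel, ← hw]
    abel
  have hv1 : norm2 v ≤ norm2 v₀ + ρ := by
    have := norm2_add_le v₀ (v - v₀)
    rw [add_sub_cancel] at this
    linarith
  have hw1 : norm2 w ≤ norm2 Δ + norm2 (w - Δ) := by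
    have := norm2_add_le Δ (w - Δ)
    rwa [add_sub_cancel] at this
  have hDn : norm2 (D *ᵥ (w - Δ)) ≤ ρ + K * ε * (norm2 v₀ + ρ) + q * norm2 w := by
    rw [hdiff]
    have h1 := StableIPM.norm2_sub_le ((v - v₀) + δv) ((G - D) *ᵥ w + δG *ᵥ w)
    have h2 := norm2_add_le (v - v₀) δv
    have h3 := norm2_add_le ((G - D) *ᵥ w) (δG *ᵥ w)
    have h4 := (norm2_mulVec_le (G - D) w).trans
      (mul_le_mul_of_nonneg_right hη (norm2_nonneg w))
    have h5 := (norm2_mulVec_le δG w).trans (mul_le_mul_of_nonneg_right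
      (hδG.trans (mul_le_mul_of_nonneg_left hg hKε)) (norm2_nonneg w))
    have h6 := mul_le_mul_of_nonneg_left hv1 hKε
    have h7 : q * norm2 w = η * norm2 w + K * ε * g * norm2 w := by rw [hq]; ring
    linarith
  have hmain : norm2 (w - Δ) ≤ 2 * R * (2 * ρ + K * ε * norm2 v₀ + q * norm2 Δ) := by
    have h1 := (hD (w - Δ)).trans (mul_le_mul_of_nonneg_left hDn hR)
    -- The unknown `‖w‖` is split as `‖Δ‖ + ‖w - Δ‖`; as `R q ≤ 1/2`, half of `‖w - Δ‖` is absorbed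
    -- on the left, which doubles `R`.
    have h2 : R * (q * norm2 w) ≤ R * (q * norm2 Δ) + 1 / 2 * norm2 (w - Δ) := by
      have h3 := mul_le_mul_of_nonneg_left hw1 (mul_nonneg hR hq0)
      have h4 := mul_le_mul_of_nonneg_right hsmall (norm2_nonneg (w - Δ))
      nlinarith
    have h5 : R * (K * ε * ρ) ≤ R * ρ :=
      mul_le_mul_of_nonneg_left (mul_le_of_le_one_left hρ hKε1) hR
    nlinarith
  have h1 := norm2_add_le (u - w) (w - Δ)
  rw [sub_add_sub_cancel] at h1
  have h2 := huw.trans (mul_le_mul_of_nonneg_left hw1 hKε)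
  have h3 := mul_le_of_le_one_left (norm2_nonneg (w - Δ)) hKε1
  linarith

end MatrixNorm

/-! ### Floating-point summation -/

/-- Induction on the bracketing: a rounded addition at most doubles the accumulated relative error
and adds one `ε`, as in `2 (E - 1) + 1 = 2 E - 1`. The exponential factor is crude, but depends only
on the number of summands. -/
theorem FloatSum.abs_sub_sum_le {ε : ℝ} (hε : 0 ≤ ε) (hε1 : ε ≤ 1) {s : Multiset ℝ} {y : ℝ}
    (h : FloatSum ε s y) :
    |y - s.sum| ≤ (2 ^ s.card - 1) * ε * (s.map abs).sum := by
  induction h with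
  | single a => simpa using mul_nonneg (by norm_num; exact hε) (abs_nonneg a)
  | @add s t a b y hs ht hy ihs iht =>
    -- Neither part of a sum is empty, so each part has fewer summands than the whole, and `E` with
    -- one summand less dominates both induction hypotheses.
    have key : ∀ {s : Multiset ℝ} {y : ℝ}, FloatSum ε s y → 1 ≤ s.card := by
      intro s y h
      induction h with
      | single a => simp
      | add _ _ _ h1 _ => rw [Multiset.card_add]; omega
    have hs1 := key hs
    have ht1 := key ht
    set S := (s.map abs).sum
    set T := (t.map abs).sum
    have hS : |s.sum| ≤ S := Multiset.abs_sum_le_sum_abs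
    have hT : |t.sum| ≤ T := Multiset.abs_sum_le_sum_abs
    have hS0 := (abs_nonneg _).trans hS
    have hT0 := (abs_nonneg _).trans hT
    rw [Multiset.map_add, Multiset.sum_add, Multiset.sum_add, Multiset.card_add]
    set E : ℝ := 2 ^ (s.card + t.card - 1) with hE
    have hE2 : (2 : ℝ) ^ (s.card + t.card) = 2 * E := by
      rw [hE, ← pow_succ']
      congr 1
      omega
    have hsE : (2 : ℝ) ^ s.card ≤ E := pow_le_pow_right₀ (by norm_num) (by omega)
    have htE : (2 : ℝ) ^ t.card ≤ E := pow_le_pow_right₀ (by norm_num) (by omega)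
    have hE1 : 1 ≤ E := one_le_pow₀ (by norm_num)
    have h1 : |a - s.sum| ≤ (E - 1) * ε * S := ihs.trans (by gcongr)
    have h2 : |b - t.sum| ≤ (E - 1) * ε * T := iht.trans (by gcongr)
    have h3 : |a + b| ≤ (S + T) + (E - 1) * ε * (S + T) := by
      rw [abs_le] at *
      constructor <;> nlinarith
    have h4 : |y - (a + b)| ≤ ε * ((S + T) + (E - 1) * ε * (S + T)) :=
      hy.trans (mul_le_mul_of_nonneg_left h3 hε)
    have h5 : ε * ((E - 1) * ε * (S + T)) ≤ (E - 1) * ε * (S + T) :=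
      mul_le_of_le_one_left (mul_nonneg (mul_nonneg (by linarith) hε) (by linarith)) hε1
    rw [hE2]
    rw [abs_le] at h1 h2 h4 ⊢
    constructor <;> nlinarith

theorem FloatSum.abs_sub_sum_le_of_abs_le {ε B : ℝ} (hε : 0 ≤ ε) (hε1 : ε ≤ 1) (hB : 0 ≤ B)
    {s : Multiset ℝ} {y : ℝ} {k : ℕ} (h : FloatSum ε s y) (hk : s.card ≤ k)
    (hs : ∀ a ∈ s, |a| ≤ B) : |y - s.sum| ≤ 2 ^ k * k * B * ε := by
  have h1 := h.abs_sub_sum_le hε hε1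
  have h2 : (s.map abs).sum ≤ k * B := by
    have h3 : (s.map abs).sum ≤ (s.map abs).card • B :=
      Multiset.sum_le_card_nsmul _ _ (by simpa using hs)
    rw [Multiset.card_map, nsmul_eq_mul] at h3
    have : (s.card : ℝ) ≤ k := by exact_mod_cast hk
    exact h3.trans (by gcongr)
  have h4 : (2 : ℝ) ^ s.card ≤ 2 ^ k := pow_le_pow_right₀ (by norm_num) hk
  have h5 : 0 ≤ (s.map abs).sum := Multiset.sum_nonneg (by simp +contextual)
  calc _ ≤ (2 ^ s.card - 1) * ε * (s.map abs).sum := h1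
    _ ≤ 2 ^ k * ε * (k * B) := by gcongr; linarith
    _ = _ := by ring

theorem Rounds.abs_sub_le {ε x y : ℝ} (h : Rounds ε x y) : |y - x| ≤ ε * |x| := h

theorem Rounds.abs_le {ε x y : ℝ} (h : Rounds ε x y) (hε1 : ε ≤ 1) : |y| ≤ 2 * |x| := by
  have h1 := h.abs_sub_le
  have h2 : |y| ≤ |x| + |y - x| := by simpa using abs_add_le x (y - x)
  nlinarith [abs_nonneg x]

/-- A rounded product of a rounded datum with an exact factor. -/
theorem Rounds.abs_mul_sub_le {ε a a' x y : ℝ} (ha : Rounds ε a a') (hy : Rounds ε (a' * x) y)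
    (hε : 0 ≤ ε) (hε1 : ε ≤ 1) : |y - a * x| ≤ 3 * (|a| * |x|) * ε := by
  have h1 := hy.abs_sub_le
  have h2 := ha.abs_sub_le
  have h3 := ha.abs_le hε1
  have h4 : |a' * x - a * x| ≤ ε * |a| * |x| := by
    rw [← sub_mul, abs_mul]
    gcongr
  have h5 : ε * |a' * x| ≤ ε * (2 * |a| * |x|) := by
    rw [abs_mul]
    gcongr
  have h6 := _root_.abs_sub_le y (a' * x) (a * x)
  linarith

/-! ### Blocks of primal-dual vectors -/

section BlockLemmas

variable {n m : ℕ}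

theorem PD.norm2_sq_eq (z : PD n m) :
    norm2 z ^ 2 = norm2 z.x ^ 2 + norm2 z.lam ^ 2 + norm2 z.muL ^ 2 + norm2 z.muR ^ 2 := by
  simp only [norm2_sq, Fintype.sum_sum_type, PD.x, PD.lam, PD.muL, PD.muR]
  ring

theorem PD.norm2_x_le (z : PD n m) : norm2 z.x ≤ norm2 z := by
  refine abs_le_of_sq_le_sq' ?_ (norm2_nonneg z) |>.2
  rw [z.norm2_sq_eq]
  nlinarith

theorem PD.norm2_lam_le (z : PD n m) : norm2 z.lam ≤ norm2 z := by
  refine abs_le_of_sq_le_sq' ?_ (norm2_nonneg z) |>.2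
  rw [z.norm2_sq_eq]
  nlinarith

theorem PD.norm2_muL_le (z : PD n m) : norm2 z.muL ≤ norm2 z := by
  refine abs_le_of_sq_le_sq' ?_ (norm2_nonneg z) |>.2
  rw [z.norm2_sq_eq]
  nlinarith

theorem PD.norm2_muR_le (z : PD n m) : norm2 z.muR ≤ norm2 z := by
  refine abs_le_of_sq_le_sq' ?_ (norm2_nonneg z) |>.2
  rw [z.norm2_sq_eq]
  nlinarith

theorem PD.norm2_sumElim_mu_le (z : PD n m) : norm2 (Sum.elim z.muL z.muR) ≤ norm2 z := by
  refine abs_le_of_sq_le_sq' ?_ (norm2_nonneg z) |>.2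
  rw [z.norm2_sq_eq, norm2_sumElim_sq]
  nlinarith

theorem PD.norm2_le_add (z : PD n m) :
    norm2 z ≤ norm2 z.x + norm2 z.lam + norm2 z.muL + norm2 z.muR := by
  have h1 := norm2_nonneg z.x
  have h2 := norm2_nonneg z.lam
  have h3 := norm2_nonneg z.muL
  have h4 := norm2_nonneg z.muR
  refine abs_le_of_sq_le_sq' ?_ (by positivity) |>.2
  rw [z.norm2_sq_eq]
  nlinarith [mul_nonneg h1 h2, mul_nonneg (add_nonneg h1 h2) h3,
    mul_nonneg (add_nonneg (add_nonneg h1 h2) h3) h4]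

@[simp] theorem PD.x_mk (a : Fin n → ℝ) (b : Fin m → ℝ) (c d : Fin n → ℝ) :
    (PD.mk a b c d).x = a := rfl
@[simp] theorem PD.lam_mk (a : Fin n → ℝ) (b : Fin m → ℝ) (c d : Fin n → ℝ) :
    (PD.mk a b c d).lam = b := rfl
@[simp] theorem PD.muL_mk (a : Fin n → ℝ) (b : Fin m → ℝ) (c d : Fin n → ℝ) :
    (PD.mk a b c d).muL = c := rfl
@[simp] theorem PD.muR_mk (a : Fin n → ℝ) (b : Fin m → ℝ) (c d : Fin n → ℝ) :
    (PD.mk a b c d).muR = d := rfl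

@[simp] theorem PD.x_add (z w : PD n m) : (z + w).x = z.x + w.x := rfl
@[simp] theorem PD.lam_add (z w : PD n m) : (z + w).lam = z.lam + w.lam := rfl
@[simp] theorem PD.muL_add (z w : PD n m) : (z + w).muL = z.muL + w.muL := rfl
@[simp] theorem PD.muR_add (z w : PD n m) : (z + w).muR = z.muR + w.muR := rfl
@[simp] theorem PD.x_sub (z w : PD n m) : (z - w).x = z.x - w.x := rfl
@[simp] theorem PD.lam_sub (z w : PD n m) : (z - w).lam = z.lam - w.lam := rfl
@[simp] theorem PD.muL_sub (z w : PD n m) : (z - w).muL = z.muL - w.muL := rfl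
@[simp] theorem PD.muR_sub (z w : PD n m) : (z - w).muR = z.muR - w.muR := rfl
@[simp] theorem PD.x_neg (z : PD n m) : (-z).x = -z.x := rfl
@[simp] theorem PD.lam_neg (z : PD n m) : (-z).lam = -z.lam := rfl

theorem PD.mk_eta (z : PD n m) : PD.mk z.x z.lam z.muL z.muR = z := by
  ext (i | i | i | i) <;> rfl

theorem PD.mk_inj {a a' : Fin n → ℝ} {b b' : Fin m → ℝ} {c c' d d' : Fin n → ℝ}
    (h : PD.mk a b c d = PD.mk a' b' c' d') : a = a' ∧ b = b' ∧ c = c' ∧ d = d' :=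
  ⟨congrArg PD.x h, congrArg PD.lam h, congrArg PD.muL h, congrArg PD.muR h⟩

theorem jacF_mulVec (Q : Matrix (Fin n) (Fin n) ℝ) (A : Matrix (Fin m) (Fin n) ℝ) (ω : ℝ)
    (z d : PD n m) :
    jacF Q A ω z *ᵥ d =
      PD.mk (Q *ᵥ d.x + ω • d.x - Aᵀ *ᵥ d.lam - d.muL + d.muR) (A *ᵥ d.x + ω • d.lam)
        (z.muL * d.x + (1 + z.x) * d.muL) (-(z.muR * d.x) + (1 - z.x) * d.muR) := by
  have hd : d = Sum.elim d.x (Sum.elim d.lam (Sum.elim d.muL d.muR)) := (PD.mk_eta d).symm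
  conv_lhs => rw [hd]
  rw [jacF, Matrix.fromBlocks_mulVec]
  simp only [Sum.elim_comp_inl, Sum.elim_comp_inr, Matrix.fromCols_mulVec_sumElim,
    Matrix.fromRows_mulVec, Matrix.fromBlocks_mulVec, Matrix.zero_mulVec, add_zero, zero_add,
    Matrix.add_mulVec, Matrix.smul_mulVec, Matrix.neg_mulVec, Matrix.one_mulVec]
  ext (i | i | i | i) <;> simp [PD.mk, Matrix.mulVec_diagonal]
  ring

end BlockLemmas

/-! ### Regularity of the Jacobian -/

section Jacobian

variable {n m : ℕ}

/-- Divide the complementarity rows by `μL` and `μR` and pair the result with `d`. The couplings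
through `A` and `±I` then cancel, leaving `xᵀQx`, `ω` times the squares of the first two blocks, and
the squares of the multiplier blocks with weights `(1 ± x) / μ ≥ γ / B`. Cauchy–Schwarz finishes the
proof; the row scaling costs the factor `1 / γ`. -/
theorem norm2_le_mul_norm2_jacF_mulVec {Q : Matrix (Fin n) (Fin n) ℝ} (hQ : Q.PosSemidef)
    (A : Matrix (Fin m) (Fin n) ℝ) {ω γ B : ℝ} (hω : 0 < ω) (hγ : 0 < γ) (hγ1 : γ ≤ 1)
    {z : PD n m} (hL : ∀ j, γ ≤ z.muL j ∧ z.muL j ≤ B) (hR : ∀ j, γ ≤ z.muR j ∧ z.muR j ≤ B)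
    (hxL : ∀ j, γ ≤ 1 + z.x j) (hxR : ∀ j, γ ≤ 1 - z.x j) (d : PD n m) :
    norm2 d ≤ 1 / γ * max (1 / ω) (B / γ) * norm2 (jacF Q A ω z *ᵥ d) := by
  set r : PD n m := jacF Q A ω z *ᵥ d with hr
  obtain ⟨h1, h2, h3, h4⟩ := PD.mk_inj ((PD.mk_eta r).trans (hr.trans (jacF_mulVec Q A ω z d)))
  set M := max (1 / ω) (B / γ) with hM
  have hM0 : 0 < M := lt_max_of_lt_left (by positivity)
  have hMω : 1 ≤ M * ω := by
    have := le_max_left (1 / ω) (B / γ)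
    rwa [div_le_iff₀ hω] at this
  have hMB : B ≤ M * γ := by
    have := le_max_right (1 / ω) (B / γ)
    rwa [div_le_iff₀ hγ] at this
  set w : PD n m := PD.mk r.x r.lam (r.muL / z.muL) (r.muR / z.muR) with hw
  have hwr : norm2 w ≤ 1 / γ * norm2 r := by
    -- Here `γ ≤ 1` enters: the unscaled rows must obey the same factor `1 / γ`.
    have hγ' : 1 ≤ 1 / γ := by rw [le_div_iff₀ hγ]; linarith
    refine norm2_le_mul_of_abs_le (by positivity) ?_
    have hdiv : ∀ a b : ℝ, γ ≤ b → |a / b| ≤ 1 / γ * |a| := by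
      intro a b hb
      rw [abs_div, abs_of_pos (hγ.trans_le hb), one_div_mul_eq_div]
      gcongr
    rintro (i | i | i | i)
    · exact le_mul_of_one_le_left (abs_nonneg _) hγ'
    · exact le_mul_of_one_le_left (abs_nonneg _) hγ'
    · exact hdiv _ _ (hL i).1
    · exact hdiv _ _ (hR i).1
  have hdual : d.x ⬝ᵥ (Aᵀ *ᵥ d.lam) = d.lam ⬝ᵥ (A *ᵥ d.x) := by
    rw [Matrix.mulVec_transpose, dotProduct_comm, Matrix.dotProduct_mulVec]
  have hpsd : 0 ≤ d.x ⬝ᵥ (Q *ᵥ d.x) := by simpa using hQ.dotProduct_mulVec_nonneg d.x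
  have hsum : ∑ k, d k * w k = d.x ⬝ᵥ r.x + d.lam ⬝ᵥ r.lam + d.muL ⬝ᵥ (r.muL / z.muL)
      + d.muR ⬝ᵥ (r.muR / z.muR) := by
    simp only [Fintype.sum_sum_type, dotProduct]
    rw [← add_assoc, ← add_assoc]
    rfl
  have hself : ∀ {k : ℕ} (v : Fin k → ℝ), v ⬝ᵥ v = norm2 v ^ 2 := by
    intro k v
    rw [norm2_sq]
    simp [dotProduct, sq]
  have hLterm : norm2 d.muL ^ 2 ≤ M * (d.muL ⬝ᵥ (r.muL / z.muL) - d.muL ⬝ᵥ d.x) := by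
    rw [norm2_sq, ← dotProduct_sub, dotProduct, Finset.mul_sum]
    refine Finset.sum_le_sum fun j _ => ?_
    have hpos := hγ.trans_le (hL j).1
    have : (r.muL / z.muL - d.x) j = (1 + z.x j) / z.muL j * d.muL j := by
      rw [h3]
      simp
      field_simp
      ring
    rw [this]
    have hc : 1 ≤ M * ((1 + z.x j) / z.muL j) := by
      rw [← mul_div_assoc, le_div_iff₀ hpos, one_mul]
      exact ((hL j).2.trans hMB).trans (mul_le_mul_of_nonneg_left (hxL j) hM0.le)
    nlinarith [sq_nonneg (d.muL j)]
  have hRterm : norm2 d.muR ^ 2 ≤ M * (d.muR ⬝ᵥ (r.muR / z.muR) + d.muR ⬝ᵥ d.x) := by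
    rw [norm2_sq, ← dotProduct_add, dotProduct, Finset.mul_sum]
    refine Finset.sum_le_sum fun j _ => ?_
    have hpos := hγ.trans_le (hR j).1
    have : (r.muR / z.muR + d.x) j = (1 - z.x j) / z.muR j * d.muR j := by
      rw [h4]
      simp
      field_simp
      ring
    rw [this]
    have hc : 1 ≤ M * ((1 - z.x j) / z.muR j) := by
      rw [← mul_div_assoc, le_div_iff₀ hpos, one_mul]
      exact ((hR j).2.trans hMB).trans (mul_le_mul_of_nonneg_left (hxR j) hM0.le)
    nlinarith [sq_nonneg (d.muR j)]
  have hkey : norm2 d ^ 2 ≤ M * ∑ k, d k * w k := by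
    rw [d.norm2_sq_eq, hsum, h1, h2]
    simp only [dotProduct_add, dotProduct_sub, dotProduct_smul, smul_eq_mul, hself]
    rw [hdual, dotProduct_comm d.x d.muL, dotProduct_comm d.x d.muR]
    nlinarith [sq_nonneg (norm2 d.x), sq_nonneg (norm2 d.lam), mul_nonneg hM0.le hpsd]
  have hCS := (sum_mul_le_norm2_mul d w).trans
    (mul_le_mul_of_nonneg_left hwr (norm2_nonneg d))
  rcases (norm2_nonneg d).eq_or_lt with h0 | h0
  · rw [← h0]
    have := norm2_nonneg r
    positivity
  · refine le_of_mul_le_mul_left ?_ h0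
    calc norm2 d * norm2 d = norm2 d ^ 2 := (sq _).symm
      _ ≤ _ := hkey.trans (mul_le_mul_of_nonneg_left hCS hM0.le)
      _ = _ := by ring

theorem abs_jacF_le {Q : Matrix (Fin n) (Fin n) ℝ} {A : Matrix (Fin m) (Fin n) ℝ} {ω B : ℝ}
    (hω : 0 ≤ ω) {z : PD n m} (hz : norm2 z ≤ B) (k l : Idx n m) :
    |jacF Q A ω z k l| ≤ ‖Q‖ + ω + normF A + 1 + B := by
  have hB := (norm2_nonneg z).trans hz
  have hQ0 := norm_nonneg Q
  have hA0 := normF_nonneg A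
  have hentry : ∀ k, |z k| ≤ B := fun k => (abs_le_norm2 z k).trans hz
  have hone : ∀ i j : Fin n, |(1 : Matrix (Fin n) (Fin n) ℝ) i j| ≤ 1 := by
    intro i j
    rw [Matrix.one_apply]
    split_ifs <;> simp
  have hdiag : ∀ (v : Fin n → ℝ) (b : ℝ), 0 ≤ b → (∀ i, |v i| ≤ b) → ∀ i j,
      |Matrix.diagonal v i j| ≤ b := by
    intro v b hb hv i j
    rw [Matrix.diagonal_apply]
    split_ifs
    · exact hv i
    · simpa using hb
  rcases k with i | i | i | i <;> rcases l with j | j | j | j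
  · have h1 := abs_entry_le_l2_opNorm Q i j
    have h2 := abs_add_le (Q i j) (ω * (1 : Matrix (Fin n) (Fin n) ℝ) i j)
    rw [abs_mul, abs_of_nonneg hω] at h2
    have h3 := mul_le_mul_of_nonneg_left (hone i j) hω
    simp only [jacF, Matrix.fromBlocks_apply₁₁, Matrix.add_apply, Matrix.smul_apply, smul_eq_mul]
    linarith
  · have := abs_entry_le_normF A j i
    simp [jacF]
    linarith
  · have := hone i j
    simp [jacF]
    linarith
  · have := hone i j
    simp [jacF]
    linarith
  · have := abs_entry_le_normF A i j
    simp [jacF]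
    linarith
  · simp only [jacF, Matrix.fromBlocks_apply₂₂, Matrix.fromBlocks_apply₁₁, Matrix.smul_apply,
      Matrix.one_apply, smul_eq_mul]
    split_ifs
    · simp [abs_of_nonneg hω]
      linarith
    · simp
      linarith
  · simp [jacF]
    linarith
  · simp [jacF]
    linarith
  · have := hdiag z.muL B hB (fun i => hentry _) i j
    simp [jacF]
    linarith
  · simp [jacF]
    linarith
  · have := hdiag (1 + z.x) (1 + B) (by linarith) (fun i => ?_) i j
    · change |Matrix.diagonal (1 + z.x) i j| ≤ _
      linarith
    · have h1 := abs_add_le 1 (z.x i)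
      have h2 : |z.x i| ≤ B := hentry _
      simp at h1 ⊢
      linarith
  · simp [jacF]
    linarith
  · have := hdiag z.muR B hB (fun i => hentry _) i j
    change |-(Matrix.diagonal z.muR i j)| ≤ _
    rw [abs_neg]
    linarith
  · simp [jacF]
    linarith
  · simp [jacF]
    linarith
  · have := hdiag (1 - z.x) (1 + B) (by linarith) (fun i => ?_) i j
    · change |Matrix.diagonal (1 - z.x) i j| ≤ _
      linarith
    · have h1 := abs_sub 1 (z.x i)
      have h2 : |z.x i| ≤ B := hentry _
      simp at h1 ⊢
      linarith

/-- Rounding `Q` and `A` changes each entry of the Jacobian by a small relative error. -/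
theorem abs_jacF_sub_le {Q Q' : Matrix (Fin n) (Fin n) ℝ} {A A' : Matrix (Fin m) (Fin n) ℝ}
    {ε : ℝ} (hε : 0 ≤ ε) (hQ : ∀ i j, Rounds ε (Q i j) (Q' i j))
    (hA : ∀ i j, Rounds ε (A i j) (A' i j)) (ω : ℝ) (z : PD n m) (k l : Idx n m) :
    |jacF Q' A' ω z k l - jacF Q A ω z k l| ≤ ε * (‖Q‖ + normF A) := by
  have hQ0 := norm_nonneg Q
  have hA0 := normF_nonneg A
  have hQ' : ∀ i j, |Q' i j - Q i j| ≤ ε * (‖Q‖ + normF A) := fun i j =>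
    (hQ i j).abs_sub_le.trans (mul_le_mul_of_nonneg_left
      ((abs_entry_le_l2_opNorm Q i j).trans (by linarith)) hε)
  have hA' : ∀ i j, |A' i j - A i j| ≤ ε * (‖Q‖ + normF A) := fun i j =>
    (hA i j).abs_sub_le.trans (mul_le_mul_of_nonneg_left
      ((abs_entry_le_normF A i j).trans (by linarith)) hε)
  have h0 : 0 ≤ ε * (‖Q‖ + normF A) := by positivity
  rcases k with i | i | i | i <;> rcases l with j | j | j | j
  · simpa [jacF] using hQ' i j
  · have := hA' j i
    rw [abs_sub_comm] at this
    simpa [jacF, add_comm, sub_eq_add_neg] using this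
  · simpa [jacF] using h0
  · simpa [jacF] using h0
  · simpa [jacF] using hA' i j
  all_goals simpa [jacF] using h0

end Jacobian

/-! ### The optimality function -/

section OptF

variable {n m : ℕ}

theorem mem_nbhd_iff {P : BoxQP n m} {ω w τ : ℝ} {z : PD n m} :
    z ∈ nbhd P ω w τ ↔ res1 P ω z = 0 ∧ res2 P ω z = 0 ∧
      norm2 (Sum.elim (res3 τ z) (res4 τ z)) ≤ w * τ ∧
      (∀ j, |z.x j| < 1) ∧ (∀ j, 0 < z.muL j) ∧ (∀ j, 0 < z.muR j) := by
  constructor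
  · rintro ⟨r₃, r₄, h, hr, hx, hL, hR⟩
    obtain ⟨h1, h2, h3, h4⟩ := PD.mk_inj h
    subst h3 h4
    exact ⟨h1, h2, hr, (pi_norm_lt_iff one_pos).1 hx, hL, hR⟩
  · rintro ⟨h1, h2, hr, hx, hL, hR⟩
    exact ⟨_, _, by rw [optF, h1, h2], hr, (pi_norm_lt_iff one_pos).2 hx, hL, hR⟩

theorem res1_add {P : BoxQP n m} {ω : ℝ} (z d : PD n m) :
    res1 P ω (z + d) =
      res1 P ω z + (P.Q *ᵥ d.x + ω • d.x - P.Aᵀ *ᵥ d.lam - d.muL + d.muR) := by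
  simp only [res1, PD.x_add, PD.lam_add, PD.muL_add, PD.muR_add, Matrix.mulVec_add, smul_add]
  abel

theorem res2_add {P : BoxQP n m} {ω : ℝ} (z d : PD n m) :
    res2 P ω (z + d) = res2 P ω z + (P.A *ᵥ d.x + ω • d.lam) := by
  simp only [res2, PD.x_add, PD.lam_add, Matrix.mulVec_add, smul_add]
  abel

/-- Only the complementarity products are nonlinear. Their increments are written with the
multiplier at the old point and the slack at the new one, so no quadratic term in the difference
appears. The constant is the sum of those of the four blocks. -/
theorem norm2_optF_sub_le {P : BoxQP n m} {ω τ B : ℝ} (hω : 0 ≤ ω) (hB : 0 ≤ B) {z z' : PD n m}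
    (hL : ∀ j, |z.muL j| ≤ B) (hR : ∀ j, |z.muR j| ≤ B) (hx : ∀ j, |z'.x j| ≤ 1) :
    norm2 (optF P ω τ z' - optF P ω τ z) ≤
      (‖P.Q‖ + 2 * ω + 2 * normF P.A + 6 + 2 * B) * norm2 (z' - z) := by
  obtain ⟨d, rfl⟩ : ∃ d, z' = z + d := ⟨z' - z, by simp⟩
  rw [add_sub_cancel_left]
  have hd := norm2_nonneg d
  have hdx := d.norm2_x_le
  have hdl := d.norm2_lam_le
  have hdL := d.norm2_muL_le
  have hdR := d.norm2_muR_le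
  have hQ0 := norm_nonneg P.Q
  have hA0 := normF_nonneg P.A
  have e1 : norm2 (optF P ω τ (z + d) - optF P ω τ z).x ≤
      (‖P.Q‖ + ω + normF P.A + 2) * norm2 d := by
    have : (optF P ω τ (z + d) - optF P ω τ z).x =
        P.Q *ᵥ d.x + ω • d.x - P.Aᵀ *ᵥ d.lam - d.muL + d.muR := by
      simp [optF, res1_add]
    rw [this]
    have h1 := norm2_add_le (P.Q *ᵥ d.x + ω • d.x - P.Aᵀ *ᵥ d.lam - d.muL) d.muR
    have h2 := norm2_sub_le (P.Q *ᵥ d.x + ω • d.x - P.Aᵀ *ᵥ d.lam) d.muL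
    have h3 := norm2_sub_le (P.Q *ᵥ d.x + ω • d.x) (P.Aᵀ *ᵥ d.lam)
    have h4 := norm2_add_le (P.Q *ᵥ d.x) (ω • d.x)
    rw [norm2_smul, abs_of_nonneg hω] at h4
    have h5 := norm2_mulVec_le P.Q d.x
    have h6 := norm2_mulVec_le_normF P.Aᵀ d.lam
    rw [normF_transpose] at h6
    have h7 := mul_le_mul_of_nonneg_left hdx hQ0
    have h8 := mul_le_mul_of_nonneg_left hdx hω
    have h9 := mul_le_mul_of_nonneg_left hdl hA0
    linarith
  have e2 : norm2 (optF P ω τ (z + d) - optF P ω τ z).lam ≤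
      (ω + normF P.A) * norm2 d := by
    have : (optF P ω τ (z + d) - optF P ω τ z).lam = P.A *ᵥ d.x + ω • d.lam := by
      simp [optF, res2_add]
    rw [this]
    have h4 := norm2_add_le (P.A *ᵥ d.x) (ω • d.lam)
    rw [norm2_smul, abs_of_nonneg hω] at h4
    have h6 := norm2_mulVec_le_normF P.A d.x
    have h8 := mul_le_mul_of_nonneg_left hdl hω
    have h9 := mul_le_mul_of_nonneg_left hdx hA0
    linarith
  have e3 : norm2 (optF P ω τ (z + d) - optF P ω τ z).muL ≤ (B + 2) * norm2 d := by
    have : (optF P ω τ (z + d) - optF P ω τ z).muL =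
        z.muL * d.x + (1 + (z + d).x) * d.muL := by
      ext j
      simp [optF, res3]
      ring
    rw [this]
    have h1 := norm2_add_le (z.muL * d.x) ((1 + (z + d).x) * d.muL)
    have h2 : norm2 (z.muL * d.x) ≤ B * norm2 d.x := norm2_le_mul_of_abs_le hB fun j => by
      rw [Pi.mul_apply, abs_mul]
      exact mul_le_mul_of_nonneg_right (hL j) (abs_nonneg _)
    have h3 : norm2 ((1 + (z + d).x) * d.muL) ≤ 2 * norm2 d.muL :=
      norm2_le_mul_of_abs_le two_pos.le fun j => by
        rw [Pi.mul_apply, abs_mul]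
        have := abs_le.1 (hx j)
        exact mul_le_mul_of_nonneg_right (abs_le.2 ⟨by simp at *; linarith, by simp at *; linarith⟩)
          (abs_nonneg _)
    have h4 := mul_le_mul_of_nonneg_left hdx hB
    linarith
  have e4 : norm2 (optF P ω τ (z + d) - optF P ω τ z).muR ≤ (B + 2) * norm2 d := by
    have : (optF P ω τ (z + d) - optF P ω τ z).muR =
        (1 - (z + d).x) * d.muR - z.muR * d.x := by
      ext j
      simp [optF, res4]
      ring
    rw [this]
    have h1 := norm2_sub_le ((1 - (z + d).x) * d.muR) (z.muR * d.x)
    have h2 : norm2 (z.muR * d.x) ≤ B * norm2 d.x := norm2_le_mul_of_abs_le hB fun j => by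
      rw [Pi.mul_apply, abs_mul]
      exact mul_le_mul_of_nonneg_right (hR j) (abs_nonneg _)
    have h3 : norm2 ((1 - (z + d).x) * d.muR) ≤ 2 * norm2 d.muR :=
      norm2_le_mul_of_abs_le two_pos.le fun j => by
        rw [Pi.mul_apply, abs_mul]
        have := abs_le.1 (hx j)
        exact mul_le_mul_of_nonneg_right (abs_le.2 ⟨by simp at *; linarith, by simp at *; linarith⟩)
          (abs_nonneg _)
    have h4 := mul_le_mul_of_nonneg_left hdx hB
    linarith
  have := PD.norm2_le_add (optF P ω τ (z + d) - optF P ω τ z)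
  linarith

end OptF

/-! ### Consequences of the parameter rules -/

section ParamBounds

variable {n m : ℕ} {P : BoxQP n m} {tol τ : ℝ} {p : Params}

namespace Params.Admissible

theorem one_le_Cz (h : p.Admissible P tol) (hn : 1 ≤ n) : 1 ≤ p.Cz := by
  have h1 := h.Cz_ge
  have h2 : 1 ≤ √((n : ℝ) + p.Clam ^ 2 + p.Cμ ^ 2) := by
    rw [Real.one_le_sqrt]
    have : (1 : ℝ) ≤ n := by exact_mod_cast hn
    nlinarith [sq_nonneg p.Clam, sq_nonneg p.Cμ]
  linarith

theorem Cμ_le_Cz (h : p.Admissible P tol) : p.Cμ ≤ p.Cz := by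
  have h1 := h.Cz_ge
  have h2 : p.Cμ ≤ √((n : ℝ) + p.Clam ^ 2 + p.Cμ ^ 2) := by
    refine Real.le_sqrt_of_sq_le ?_
    have : (0 : ℝ) ≤ n := n.cast_nonneg
    nlinarith [sq_nonneg p.Clam]
  linarith

theorem Clam_le_Cz (h : p.Admissible P tol) : p.Clam ≤ p.Cz := by
  have h1 := h.Cz_ge
  have h2 : p.Clam ≤ √((n : ℝ) + p.Clam ^ 2 + p.Cμ ^ 2) := by
    refine Real.le_sqrt_of_sq_le ?_
    have : (0 : ℝ) ≤ n := n.cast_nonneg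
    nlinarith [sq_nonneg p.Cμ]
  linarith

theorem ω_le_one (h : p.Admissible P tol) : p.ω ≤ 1 :=
  h.ω_le.trans ((min_le_right _ _).trans (min_le_right _ _))

theorem norm2_b_le (h : p.Admissible P tol) : norm2 P.b ≤ p.Cz := by
  have h1 := h.Clam_ge
  rw [div_le_iff₀ h.ω_pos] at h1
  have h2 : 0 ≤ ‖P.A‖ * √n := by positivity
  have h3 := mul_le_of_le_one_right h.Clam_pos.le h.ω_le_one
  linarith [h.Clam_le_Cz]

theorem one_le_sqrt_two_mul (hn : 1 ≤ n) : 1 ≤ √(2 * (n : ℝ)) := by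
  rw [Real.one_le_sqrt]
  have : (1 : ℝ) ≤ n := by exact_mod_cast hn
  linarith

theorem norm2_c_le (h : p.Admissible P tol) (hn : 1 ≤ n) : norm2 P.c ≤ p.Cz := by
  have h1 := h.CΔμ_ge
  have h2 : 0 ≤ (p.ω + ‖P.Q‖) * √n := mul_nonneg (add_nonneg h.ω_pos.le (norm_nonneg _))
    (Real.sqrt_nonneg _)
  have h3 : 0 ≤ ‖P.Aᵀ‖ * p.Clam := mul_nonneg (norm_nonneg _) h.Clam_pos.le
  have h4 : 0 ≤ (1 + p.θ) * p.τA :=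
    mul_nonneg (add_nonneg zero_le_one h.θ_pos.le) h.τA_pos.le
  have h5 := le_mul_of_one_le_left (add_nonneg h.CΔμ_pos.le h4) (one_le_sqrt_two_mul hn)
  linarith [h.Cμ_ge, h.Cμ_le_Cz]

/-- The rules give `β / √(2n) ≤ β ≤ θ ≤ 0.3`, so `σ` is at least `0.7`. -/
theorem σ_pos (h : p.Admissible P tol) (hn : 1 ≤ n) : 0 < p.σ := by
  have h1 := h.σ_ge
  have h2 : p.β / √(2 * (n : ℝ)) ≤ p.β := div_le_self h.β_pos.le (one_le_sqrt_two_mul hn)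
  have h3 := h.θ_le
  norm_num at h3
  linarith [h.β_le]

theorem στE_pos (h : p.Admissible P tol) (hn : 1 ≤ n) : 0 < p.σ * p.τE :=
  mul_pos (h.σ_pos hn) h.τE_pos

theorem gap_le (h : p.Admissible P tol) (hτ : p.σ * p.τE ≤ τ) :
    2 * p.Cgap * (1 + p.Cz) ≤ (1 - p.θ) * τ := by
  have h1 := h.Cgap_le
  have hz : 0 < 1 + p.Cz := by linarith [h.Cz_pos]
  have h2 : (1 - p.θ) / (1 + p.Cz) * p.σ * p.τE * (1 / 2) =
      (1 - p.θ) * (p.σ * p.τE) / 2 / (1 + p.Cz) := by ring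
  rw [h2, le_div_iff₀ hz] at h1
  have h3 : (1 - p.θ) * (p.σ * p.τE) ≤ (1 - p.θ) * τ :=
    mul_le_mul_of_nonneg_left hτ (by have := h.θ_le; norm_num at this; linarith)
  linarith

theorem CδDFinv_le_Cν (h : p.Admissible P tol) : 1 + p.CDFinv * p.CδF ≤ p.Cν :=
  (le_max_right _ _).trans h.Cν_ge

theorem one_le_Cν (h : p.Admissible P tol) : 1 ≤ p.Cν := by
  nlinarith [h.CδDFinv_le_Cν, mul_pos h.CDFinv_pos h.CδF_pos]

theorem Cν_mul_ν₂_le_Cgap (h : p.Admissible P tol) : p.Cν * p.ν₂ ≤ p.Cgap := by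
  have h1 := h.ν₂_le.trans ((min_le_right _ _).trans (min_le_left _ _))
  rw [le_div_iff₀ (zero_lt_one.trans_le h.one_le_Cν)] at h1
  linarith

theorem Cν_mul_CδF_mul_ν₂_le (h : p.Admissible P tol) :
    p.CδF * (p.Cν * p.ν₂) ≤ p.θ * (p.σ * p.τE) / 2 := by
  have h1 := h.ν₂_le.trans ((min_le_right _ _).trans ((min_le_right _ _).trans (min_le_right _ _)))
  rw [le_div_iff₀ (mul_pos (mul_pos two_pos (zero_lt_one.trans_le h.one_le_Cν)) h.CδF_pos)] at h1
  linarith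

theorem ν₂_le_tenth (h : p.Admissible P tol) : p.ν₂ ≤ 0.1 := h.ν₂_le.trans (min_le_left _ _)

theorem ν₀_le_one (h : p.Admissible P tol) : p.ν₀ ≤ 1 := by
  have h0 := h.one_le_Cν
  have h1 := h.ν₀_le.trans (min_le_left _ _)
  have h2 := h1.trans (div_le_self h.ν₁_pos.le h0)
  have h3 := h.ν₁_le.trans (div_le_self h.ν₂_pos.le h0)
  have h4 := h.ν₂_le_tenth
  norm_num at h4
  linarith

/-- The Lipschitz constant has `6 + 2 Cz` where `CDF` provides `4 + 4 Cz`; `Cz ≥ 1` covers the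
difference. -/
theorem lipschitz_le_CDF (h : p.Admissible P tol) (hn : 1 ≤ n) :
    ‖P.Q‖ + 2 * p.ω + 2 * normF P.A + 6 + 2 * p.Cz ≤ p.CDF := by
  linarith [h.CDF_ge, h.one_le_Cz hn]

end Params.Admissible

theorem spaceNh_subset_spaceN (hθ : 0 ≤ p.θ) (hτ : 0 ≤ τ) : spaceNh P p τ ⊆ spaceN P p τ := by
  intro z hz
  obtain ⟨h1, h2, h3, h4⟩ := mem_nbhd_iff.1 hz
  refine mem_nbhd_iff.2 ⟨h1, h2, h3.trans ?_, h4⟩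
  exact mul_le_mul_of_nonneg_right (by norm_num; linarith) hτ

theorem abs_res_le_of_mem_spaceN {z : PD n m} (hz : z ∈ spaceN P p τ) (j : Fin n) :
    |z.muL j * (1 + z.x j) - τ| ≤ p.θ * τ ∧ |z.muR j * (1 - z.x j) - τ| ≤ p.θ * τ := by
  obtain ⟨-, -, h3, -⟩ := mem_nbhd_iff.1 hz
  exact ⟨(abs_le_norm2 _ (Sum.inl j)).trans h3, (abs_le_norm2 _ (Sum.inr j)).trans h3⟩

/-- The equation `r² = 0` bounds `λ`, and `r¹ = 0` bounds `μL - μR`. In each coordinate one of the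
slacks `1 ± x` is at least `1`, so the corresponding multiplier is at most `(1 + θ) τ`, and the
difference bounds the other. The margin `0.1` leaves room for the envelope of radius `ν₂`. -/
theorem norm2_le_of_mem_spaceN (h : p.Admissible P tol) (hτ : τ ≤ p.τA) {z : PD n m}
    (hz : z ∈ spaceN P p τ) : norm2 z ≤ p.Cz - 0.1 := by
  obtain ⟨h1, h2, -, hx, hL, hR⟩ := mem_nbhd_iff.1 hz
  have hω := h.ω_pos
  have hnx : norm2 z.x ≤ √n := by
    simpa using norm2_le_sqrt_card_mul zero_le_one fun j => (hx j).le
  have hnl : norm2 z.lam ≤ p.Clam := by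
    refine le_trans ?_ h.Clam_ge
    rw [le_div_iff₀ hω]
    have e : p.ω • z.lam = P.b - P.A *ᵥ z.x := by
      rw [res2] at h2
      rw [← sub_eq_zero, ← h2]
      abel
    have e1 := norm2_sub_le P.b (P.A *ᵥ z.x)
    rw [← e, norm2_smul, abs_of_pos hω] at e1
    have e2 := (norm2_mulVec_le P.A z.x).trans (mul_le_mul_of_nonneg_left hnx (norm_nonneg _))
    linarith
  set T := p.CΔμ + (1 + p.θ) * p.τA with hT
  have hdiff : norm2 (z.muL - z.muR) ≤ p.CΔμ := by
    refine le_trans ?_ h.CΔμ_ge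
    have e : z.muL - z.muR = P.Q *ᵥ z.x + p.ω • z.x + P.c - P.Aᵀ *ᵥ z.lam := by
      rw [res1] at h1
      rw [eq_comm, ← sub_eq_zero, ← h1]
      abel
    rw [e]
    have e1 := norm2_sub_le (P.Q *ᵥ z.x + p.ω • z.x + P.c) (P.Aᵀ *ᵥ z.lam)
    have e2 := norm2_add_le (P.Q *ᵥ z.x + p.ω • z.x) P.c
    have e3 := norm2_add_le (P.Q *ᵥ z.x) (p.ω • z.x)
    rw [norm2_smul, abs_of_pos hω] at e3
    have e4 := (norm2_mulVec_le P.Q z.x).trans (mul_le_mul_of_nonneg_left hnx (norm_nonneg _))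
    have e5 := (norm2_mulVec_le P.Aᵀ z.lam).trans
      (mul_le_mul_of_nonneg_left hnl (norm_nonneg _))
    have e6 := mul_le_mul_of_nonneg_left hnx hω.le
    linarith
  have hμ : ∀ j, z.muL j ≤ T ∧ z.muR j ≤ T := by
    intro j
    obtain ⟨a1, a2⟩ := abs_res_le_of_mem_spaceN hz j
    have b1 := (abs_le.1 a1).2
    have b2 := (abs_le.1 a2).2
    have b3 := abs_le.1 ((abs_le_norm2 (z.muL - z.muR) j).trans hdiff)
    rw [Pi.sub_apply] at b3
    have b4 : (1 + p.θ) * τ ≤ (1 + p.θ) * p.τA :=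
      mul_le_mul_of_nonneg_left hτ (by linarith [h.θ_pos])
    have := h.CΔμ_pos
    rcases le_total 0 (z.x j) with hj | hj
    · have := mul_nonneg (hL j).le hj
      constructor <;> linarith [b3.1, b3.2]
    · have := mul_nonneg (hR j).le (neg_nonneg.2 hj)
      constructor <;> linarith [b3.1, b3.2]
  have hT0 : 0 ≤ T := add_nonneg h.CΔμ_pos.le
    (mul_nonneg (add_nonneg zero_le_one h.θ_pos.le) h.τA_pos.le)
  have hnμ : norm2 (Sum.elim z.muL z.muR) ≤ p.Cμ := by
    refine le_trans ?_ h.Cμ_ge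
    refine (norm2_le_sqrt_card_mul hT0 ?_).trans_eq ?_
    · rintro (j | j)
      · simpa [abs_of_pos (hL j)] using (hμ j).1
      · simpa [abs_of_pos (hR j)] using (hμ j).2
    · rw [hT, two_mul, Fintype.card_sum, Fintype.card_fin, Nat.cast_add]
  have hsq : norm2 z ≤ √(n + p.Clam ^ 2 + p.Cμ ^ 2) := by
    refine Real.le_sqrt_of_sq_le ?_
    rw [z.norm2_sq_eq]
    have c0 := norm2_sumElim_sq z.muL z.muR
    have c1 : norm2 z.x ^ 2 ≤ n := by
      have := pow_le_pow_left₀ (norm2_nonneg _) hnx 2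
      rwa [Real.sq_sqrt n.cast_nonneg] at this
    have c2 := pow_le_pow_left₀ (norm2_nonneg _) hnl 2
    have c3 := pow_le_pow_left₀ (norm2_nonneg _) hnμ 2
    linarith
  linarith [h.Cz_ge]

/-- Each product of a multiplier and its slack is at least `(1 - θ) τ ≥ 2 Cgap (1 + Cz)`, while
either factor is at most `1 + Cz`; so neither can be small. The factor `2` is what
`gap_of_norm2_sub_le` spends on moving away by `Cgap`. -/
theorem gap_of_mem_spaceN (h : p.Admissible P tol) (hn : 1 ≤ n)
    (hτ : τ ∈ Set.Icc (p.σ * p.τE) p.τA) {z : PD n m} (hz : z ∈ spaceN P p τ) (j : Fin n) :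
    2 * p.Cgap ≤ z.muL j ∧ 2 * p.Cgap ≤ z.muR j ∧ 2 * p.Cgap ≤ 1 + z.x j ∧
      2 * p.Cgap ≤ 1 - z.x j := by
  obtain ⟨-, -, -, hx, hL, hR⟩ := mem_nbhd_iff.1 hz
  obtain ⟨a1, a2⟩ := abs_res_le_of_mem_spaceN hz j
  have b1 := (abs_le.1 a1).1
  have b2 := (abs_le.1 a2).1
  have hx := abs_lt.1 (hx j)
  have hg := h.gap_le hτ.1
  have hz1 := h.one_le_Cz hn
  have hnz := norm2_le_of_mem_spaceN h hτ.2 hz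
  have hz2 : norm2 z ≤ p.Cz := hnz.trans (by norm_num)
  have hLC : z.muL j ≤ p.Cz := (le_abs_self _).trans ((abs_le_norm2 z _).trans hz2)
  have hRC : z.muR j ≤ p.Cz := (le_abs_self _).trans ((abs_le_norm2 z _).trans hz2)
  have hgap := h.Cgap_pos
  have hLj := hL j
  have hRj := hR j
  have key : ∀ μ s : ℝ, 0 < μ → μ ≤ p.Cz → 0 < s → s ≤ 2 → (1 - p.θ) * τ ≤ μ * s →
      2 * p.Cgap ≤ μ ∧ 2 * p.Cgap ≤ s := by
    intro μ s hμ hμC hs hs2 hμs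
    constructor
    · nlinarith
    · have : μ * s ≤ (1 + p.Cz) * s := mul_le_mul_of_nonneg_right (by linarith) hs.le
      refine le_of_mul_le_mul_right ?_ (show 0 < 1 + p.Cz by linarith)
      linarith
  obtain ⟨c1, c2⟩ := key (z.muL j) (1 + z.x j) hLj hLC (by linarith) (by linarith) (by linarith)
  obtain ⟨c3, c4⟩ := key (z.muR j) (1 - z.x j) hRj hRC (by linarith) (by linarith) (by linarith)
  exact ⟨c1, c3, c2, c4⟩

theorem gap_of_norm2_sub_le (h : p.Admissible P tol) (hn : 1 ≤ n)
    (hτ : τ ∈ Set.Icc (p.σ * p.τE) p.τA) {z z' : PD n m} (hz : z ∈ spaceN P p τ)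
    (hd : norm2 (z' - z) ≤ p.Cgap) (j : Fin n) :
    p.Cgap ≤ z'.muL j ∧ p.Cgap ≤ z'.muR j ∧ p.Cgap ≤ 1 + z'.x j ∧ p.Cgap ≤ 1 - z'.x j := by
  obtain ⟨h1, h2, h3, h4⟩ := gap_of_mem_spaceN h hn hτ hz j
  have hk : ∀ k, |z' k - z k| ≤ p.Cgap := fun k => (abs_le_norm2 (z' - z) k).trans hd
  have e1 : |z'.x j - z.x j| ≤ p.Cgap := hk _
  have e2 : |z'.muL j - z.muL j| ≤ p.Cgap := hk _
  have e3 : |z'.muR j - z.muR j| ≤ p.Cgap := hk _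
  rw [abs_le] at e1 e2 e3
  refine ⟨?_, ?_, ?_, ?_⟩ <;> linarith [e1.1, e1.2, e2.1, e3.1]

theorem norm2_optF_sub_le_CDF (h : p.Admissible P tol) (hn : 1 ≤ n)
    (hτ : τ ∈ Set.Icc (p.σ * p.τE) p.τA) {z z' : PD n m} (hz : z ∈ spaceN P p τ)
    (hd : norm2 (z' - z) ≤ p.Cgap) :
    norm2 (optF P p.ω τ z' - optF P p.ω τ z) ≤ p.CDF * norm2 (z' - z) := by
  have hz2 : norm2 z ≤ p.Cz := (norm2_le_of_mem_spaceN h hτ.2 hz).trans (by norm_num)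
  refine (norm2_optF_sub_le h.ω_pos.le h.Cz_pos.le
    (fun j => (abs_le_norm2 z _).trans hz2) (fun j => (abs_le_norm2 z _).trans hz2)
    fun j => ?_).trans
    (mul_le_mul_of_nonneg_right (h.lipschitz_le_CDF hn) (norm2_nonneg _))
  obtain ⟨-, -, h3, h4⟩ := gap_of_norm2_sub_le h hn hτ hz hd j
  have := h.Cgap_pos
  exact abs_le.2 ⟨by linarith, by linarith⟩

/-! ### The error-reset step in exact arithmetic -/

/-- What the analysis of the error-reset step uses about its starting point. -/
theorem bounds_of_mem_spaceNhenv (h : p.Admissible P tol) (hn : 1 ≤ n)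
    (hτ : τ ∈ Set.Icc (p.σ * p.τE) p.τA) {z : PD n m} (hz : z ∈ spaceNhenv P p τ p.ν₂) :
    p.Cgap ≤ 1 ∧ norm2 z ≤ p.Cz ∧ (∀ d, norm2 d ≤ p.CDFinv * norm2 (jac P p z *ᵥ d)) ∧
      norm2 (resetRhs P p τ z) ≤ p.CδF * p.ν₂ := by
  obtain ⟨z₀, hz₀h, hd⟩ := hz
  have hτ0 : 0 ≤ τ := (h.στE_pos hn).le.trans hτ.1
  have hz₀ := spaceNh_subset_spaceN h.θ_pos.le hτ0 hz₀h
  have hdg : norm2 (z - z₀) ≤ p.Cgap :=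
    hd.trans ((le_mul_of_one_le_left h.ν₂_pos.le h.one_le_Cν).trans h.Cν_mul_ν₂_le_Cgap)
  have hgap := gap_of_norm2_sub_le h hn hτ hz₀ hdg
  -- The slacks `1 + x` and `1 - x` of one coordinate add up to `2`; such a coordinate exists since
  -- `n ≥ 1`.
  have hγ1 : p.Cgap ≤ 1 := by
    obtain ⟨-, -, h3, h4⟩ := hgap ⟨0, hn⟩
    linarith
  have hnz : norm2 z ≤ p.Cz := by
    have h1 := norm2_add_le z₀ (z - z₀)
    rw [add_sub_cancel] at h1
    linarith [norm2_le_of_mem_spaceN h hτ.2 hz₀, h.ν₂_le_tenth]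
  refine ⟨hγ1, hnz, fun d => ?_, ?_⟩
  · have hC : ∀ k, z k ≤ p.Cz := fun k => (le_abs_self _).trans ((abs_le_norm2 z k).trans hnz)
    exact (norm2_le_mul_norm2_jacF_mulVec P.Q_psd P.A h.ω_pos h.Cgap_pos hγ1
      (fun j => ⟨(hgap j).1, hC _⟩) (fun j => ⟨(hgap j).2.1, hC _⟩) (fun j => (hgap j).2.2.1)
      (fun j => (hgap j).2.2.2) d).trans
      (mul_le_mul_of_nonneg_right h.CDFinv_ge (norm2_nonneg _))
  · obtain ⟨r1, r2, -⟩ := mem_nbhd_iff.1 hz₀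
    -- The affine blocks vanish at `z₀`, so up to sign the right-hand side is part of `F(z) -
    -- F(z₀)`.
    have h1 : norm2 (resetRhs P p τ z) ≤ norm2 (optF P p.ω τ z - optF P p.ω τ z₀) := by
      refine norm2_mono ?_
      rintro (i | i | i | i)
      · have : (optF P p.ω τ z - optF P p.ω τ z₀) (Sum.inl i) = res1 P p.ω z i := by
          change res1 P p.ω z i - res1 P p.ω z₀ i = _
          simp [r1]
        rw [this]
        exact (abs_neg _).le
      · have : (optF P p.ω τ z - optF P p.ω τ z₀) (Sum.inr (Sum.inl i)) = res2 P p.ω z i := by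
          change res2 P p.ω z i - res2 P p.ω z₀ i = _
          simp [r2]
        rw [this]
        exact (abs_neg _).le
      · simp [resetRhs, PD.mk]
      · simp [resetRhs, PD.mk]
    refine h1.trans ((norm2_optF_sub_le_CDF h hn hτ hz₀ hdg).trans ?_)
    exact mul_le_mul h.CδF_ge hd (norm2_nonneg _) h.CδF_pos.le

theorem norm2_reset_le (h : p.Admissible P tol) (hn : 1 ≤ n)
    (hτ : τ ∈ Set.Icc (p.σ * p.τE) p.τA) {z Δ : PD n m} (hz : z ∈ spaceNhenv P p τ p.ν₂)
    (hΔ : jac P p z *ᵥ Δ = resetRhs P p τ z) : norm2 Δ ≤ p.CDFinv * p.CδF * p.ν₂ := by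
  obtain ⟨-, -, hinv, hrhs⟩ := bounds_of_mem_spaceNhenv h hn hτ hz
  have := (hinv Δ).trans (mul_le_mul_of_nonneg_left (hΔ ▸ hrhs) h.CDFinv_pos.le)
  linarith

/-- The affine blocks vanish by linearity. The others are compared with those at `z₀`, not at `z`:
there the residual is at most `θ τ / 2`, and the change is at most `CδF Cν ν₂ ≤ θ σ τE / 2 ≤ θ τ /
2`. -/
theorem reset_mem_spaceN (h : p.Admissible P tol) (hn : 1 ≤ n)
    (hτ : τ ∈ Set.Icc (p.σ * p.τE) p.τA) {z Δ : PD n m} (hz : z ∈ spaceNhenv P p τ p.ν₂)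
    (hΔ : jac P p z *ᵥ Δ = resetRhs P p τ z) : z + Δ ∈ spaceN P p τ := by
  have hnΔ := norm2_reset_le h hn hτ hz hΔ
  obtain ⟨z₀, hz₀h, hd⟩ := hz
  have hτ0 : 0 ≤ τ := (h.στE_pos hn).le.trans hτ.1
  have hz₀ := spaceNh_subset_spaceN h.θ_pos.le hτ0 hz₀h
  have hd' : norm2 (z + Δ - z₀) ≤ p.Cν * p.ν₂ := by
    have h1 := norm2_add_le (z - z₀) Δ
    rw [show z - z₀ + Δ = z + Δ - z₀ by abel] at h1
    have h2 := mul_le_mul_of_nonneg_right h.CδDFinv_le_Cν h.ν₂_pos.le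
    linarith
  have hdg := hd'.trans h.Cν_mul_ν₂_le_Cgap
  have hgap := gap_of_norm2_sub_le h hn hτ hz₀ hdg
  have hg0 := h.Cgap_pos
  have hlip := (norm2_optF_sub_le_CDF h hn hτ hz₀ hdg).trans
    ((mul_le_mul h.CδF_ge hd' (norm2_nonneg _) h.CδF_pos.le).trans h.Cν_mul_CδF_mul_ν₂_le)
  rw [jac, jacF_mulVec] at hΔ
  have e1 := congrArg PD.x hΔ
  have e2 := congrArg PD.lam hΔ
  obtain ⟨-, -, r34, -⟩ := mem_nbhd_iff.1 hz₀h
  refine mem_nbhd_iff.2 ⟨?_, ?_, ?_, fun j => ?_, fun j => ?_, fun j => ?_⟩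
  · rw [res1_add]
    rw [PD.x_mk] at e1
    rw [e1]
    simp [resetRhs, optF]
  · rw [res2_add]
    rw [PD.lam_mk] at e2
    rw [e2]
    simp [resetRhs, optF]
  · have h1 : norm2 (Sum.elim (res3 τ (z + Δ)) (res4 τ (z + Δ)) -
        Sum.elim (res3 τ z₀) (res4 τ z₀)) ≤
        norm2 (optF P p.ω τ (z + Δ) - optF P p.ω τ z₀) := by
      have h2 : Sum.elim (res3 τ (z + Δ)) (res4 τ (z + Δ)) - Sum.elim (res3 τ z₀) (res4 τ z₀) =
          Sum.elim (optF P p.ω τ (z + Δ) - optF P p.ω τ z₀).muL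
            (optF P p.ω τ (z + Δ) - optF P p.ω τ z₀).muR := by
        ext (j | j) <;> rfl
      rw [h2]
      exact PD.norm2_sumElim_mu_le _
    have h3 := norm2_add_le (Sum.elim (res3 τ z₀) (res4 τ z₀))
      (Sum.elim (res3 τ (z + Δ)) (res4 τ (z + Δ)) - Sum.elim (res3 τ z₀) (res4 τ z₀))
    rw [add_sub_cancel] at h3
    have h4 := mul_le_mul_of_nonneg_left hτ.1 h.θ_pos.le
    norm_num at r34
    linarith
  · obtain ⟨-, -, h3, h4⟩ := hgap j
    exact abs_lt.2 ⟨by linarith, by linarith⟩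
  · exact hg0.trans_le (hgap j).1
  · exact hg0.trans_le (hgap j).2.1

end ParamBounds

/-! ### The error-reset step in floating-point arithmetic -/

section Floating

variable {n m : ℕ} {P : BoxQP n m} {tol τ K ε : ℝ} {p : Params}

/-- Error amplification in the evaluation of one entry of the residual. -/
def entryConst (n m : ℕ) : ℝ := 2 ^ (n + m + 4) * (n + m + 4 : ℕ) * 4 + 3 * (n + m + 4 : ℕ)

theorem entryConst_nonneg (n m : ℕ) : 0 ≤ entryConst n m := by
  unfold entryConst
  positivity

/-- Error amplification of the whole error-reset step. -/
def resetConst (n m : ℕ) (K : ℝ) : ℝ :=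
  8 * (Fintype.card (Idx n m) * entryConst n m) + 5 * K
    + 16 * Fintype.card (Idx n m) ^ 2 * (1 + K) + 3

/-- Bound for the error caused by summing computed products instead of exact ones. -/
theorem abs_sum_sub_sum_le {k : ℕ} {f g : Fin k → ℝ} {a : ℝ} (h : ∀ i, |f i - g i| ≤ a) :
    |∑ i, f i - ∑ i, g i| ≤ k * a := by
  rw [← Finset.sum_sub_distrib]
  refine (Finset.abs_sum_le_sum_abs _ _).trans ((Finset.sum_le_sum fun i _ => h i).trans_eq ?_)
  simp

namespace FloatResetStep

variable {z z' : PD n m} {T : ℝ}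

/-- `T` bounds every exact summand. A product of rounded data is off by at most `3 T ε`, hence is at
most `4 T`; summing `n + m + 4` such numbers adds the exponential term of `entryConst`. -/
theorem abs_r₁_sub_le (S : FloatResetStep P p K ε z z') (hε : 0 ≤ ε) (hε1 : ε ≤ 1)
    (hQ : ∀ j k, |P.Q j k| * |z.x k| ≤ T) (hA : ∀ i j, |P.A i j| * |z.lam i| ≤ T)
    (hω : ∀ j, |p.ω * z.x j| ≤ T) (hc : ∀ j, |P.c j| ≤ T) (hL : ∀ j, |z.muL j| ≤ T)
    (hR : ∀ j, |z.muR j| ≤ T) (j : Fin n) :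
    |S.r₁ j - res1 P p.ω z j| ≤ entryConst n m * T * ε := by
  have hT : 0 ≤ T := (abs_nonneg _).trans (hc j)
  have hTε : T * ε ≤ T := mul_le_of_le_one_right hT hε1
  have q1 : ∀ k, |S.Qx j k - P.Q j k * z.x k| ≤ 3 * T * ε := fun k =>
    ((S.Q_rounds j k).abs_mul_sub_le (S.Qx_rounds j k) hε hε1).trans (by gcongr; exact hQ j k)
  have q2 : ∀ i, |S.Alam i j - P.A i j * z.lam i| ≤ 3 * T * ε := fun i =>
    ((S.A_rounds i j).abs_mul_sub_le (S.Alam_rounds i j) hε hε1).trans (by gcongr; exact hA i j)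
  have q3 := (S.ωx_rounds j).abs_sub_le.trans (mul_le_mul_of_nonneg_left (hω j) hε)
  have q4 := (S.c_rounds j).abs_sub_le.trans (mul_le_mul_of_nonneg_left (hc j) hε)
  have b1 : ∀ k, |S.Qx j k| ≤ 4 * T := fun k => by
    have h1 := hQ j k
    rw [← abs_mul] at h1
    have h2 := abs_le.1 (q1 k)
    have h3 := abs_le.1 h1
    exact abs_le.2 ⟨by linarith [h2.1, h3.1], by linarith [h2.2, h3.2]⟩
  have b2 : ∀ i, |-S.Alam i j| ≤ 4 * T := fun i => by
    have h1 := hA i j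
    rw [← abs_mul] at h1
    have h2 := abs_le.1 (q2 i)
    have h3 := abs_le.1 h1
    exact abs_le.2 ⟨by linarith [h2.2, h3.2], by linarith [h2.1, h3.1]⟩
  have b3 := ((S.ωx_rounds j).abs_le hε1).trans (mul_le_mul_of_nonneg_left (hω j) two_pos.le)
  have b4 := ((S.c_rounds j).abs_le hε1).trans (mul_le_mul_of_nonneg_left (hc j) two_pos.le)
  have hsum := (S.r₁_sum j).abs_sub_sum_le_of_abs_le (B := 4 * T) (k := n + m + 4) hε hε1
    (by linarith) (by simp) (by
      intro a ha
      simp only [Multiset.mem_add, Multiset.mem_map, Multiset.insert_eq_cons, Multiset.mem_cons,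
        Multiset.mem_singleton] at ha
      rcases ha with (⟨k, -, rfl⟩ | ⟨i, -, rfl⟩) | rfl | rfl | rfl | rfl
      · exact b1 k
      · exact b2 i
      · linarith
      · linarith
      · rw [abs_neg]
        linarith [hL j]
      · linarith [hR j])
  have s1 := abs_sum_sub_sum_le q1
  have s2 := abs_sum_sub_sum_le q2
  have e1 : res1 P p.ω z j = ∑ k, P.Q j k * z.x k + p.ω * z.x j + P.c j
      - ∑ i, P.A i j * z.lam i - z.muL j + z.muR j := by
    simp [res1, Matrix.mulVec, dotProduct]
  have e2 : (Finset.univ.val.map (fun k => S.Qx j k) + Finset.univ.val.map (fun i => -S.Alam i j) +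
      {S.ωx j, S.c j, -z.muL j, z.muR j}).sum = ∑ k, S.Qx j k - ∑ i, S.Alam i j
      + (S.ωx j + (S.c j + (-z.muL j + z.muR j))) := by
    rw [Multiset.sum_add, Multiset.sum_add]
    change ∑ k, S.Qx j k + ∑ i, -S.Alam i j + _ = _
    simp [sub_eq_add_neg]
  rw [e2] at hsum
  rw [e1]
  rw [abs_le] at *
  unfold entryConst
  push_cast at *
  have hTε0 : 0 ≤ T * ε := mul_nonneg hT hε
  constructor <;> linarith [hsum.1, hsum.2, s1.1, s1.2, s2.1, s2.2, q3.1, q3.2, q4.1, q4.2]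

theorem abs_r₂_sub_le (S : FloatResetStep P p K ε z z') (hε : 0 ≤ ε) (hε1 : ε ≤ 1)
    (hA : ∀ i j, |P.A i j| * |z.x j| ≤ T) (hω : ∀ i, |p.ω * z.lam i| ≤ T)
    (hb : ∀ i, |P.b i| ≤ T) (i : Fin m) :
    |S.r₂ i - res2 P p.ω z i| ≤ entryConst n m * T * ε := by
  have hT : 0 ≤ T := (abs_nonneg _).trans (hb i)
  have hTε : T * ε ≤ T := mul_le_of_le_one_right hT hε1
  have q1 : ∀ k, |S.Ax i k - P.A i k * z.x k| ≤ 3 * T * ε := fun k =>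
    ((S.A_rounds i k).abs_mul_sub_le (S.Ax_rounds i k) hε hε1).trans (by gcongr; exact hA i k)
  have q3 := (S.ωlam_rounds i).abs_sub_le.trans (mul_le_mul_of_nonneg_left (hω i) hε)
  have q4 := (S.b_rounds i).abs_sub_le.trans (mul_le_mul_of_nonneg_left (hb i) hε)
  have b1 : ∀ k, |S.Ax i k| ≤ 4 * T := fun k => by
    have h1 := hA i k
    rw [← abs_mul] at h1
    have h2 := abs_le.1 (q1 k)
    have h3 := abs_le.1 h1
    exact abs_le.2 ⟨by linarith [h2.1, h3.1], by linarith [h2.2, h3.2]⟩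
  have b3 := ((S.ωlam_rounds i).abs_le hε1).trans (mul_le_mul_of_nonneg_left (hω i) two_pos.le)
  have b4 := ((S.b_rounds i).abs_le hε1).trans (mul_le_mul_of_nonneg_left (hb i) two_pos.le)
  have hsum := (S.r₂_sum i).abs_sub_sum_le_of_abs_le (B := 4 * T) (k := n + m + 4) hε hε1
    (by linarith) (by simp; omega) (by
      intro a ha
      simp only [Multiset.mem_add, Multiset.mem_map, Multiset.insert_eq_cons, Multiset.mem_cons,
        Multiset.mem_singleton] at ha
      rcases ha with ⟨k, -, rfl⟩ | rfl | rfl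
      · exact b1 k
      · rw [abs_neg]
        linarith
      · linarith)
  have s1 := abs_sum_sub_sum_le q1
  have e1 : res2 P p.ω z i = ∑ k, P.A i k * z.x k - P.b i + p.ω * z.lam i := by
    simp [res2, Matrix.mulVec, dotProduct]
  have e2 : (Finset.univ.val.map (fun k => S.Ax i k) + {-S.b i, S.ωlam i}).sum =
      ∑ k, S.Ax i k + (-S.b i + S.ωlam i) := by
    rw [Multiset.sum_add]
    change ∑ k, S.Ax i k + _ = _
    simp
  rw [e2] at hsum
  rw [e1]
  rw [abs_le] at *
  unfold entryConst
  push_cast at *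
  have hTε0 : 0 ≤ T * ε := mul_nonneg hT hε
  have hm : 0 ≤ m * (T * ε) := mul_nonneg m.cast_nonneg hTε0
  constructor <;> linarith [hsum.1, hsum.2, s1.1, s1.2, q3.1, q3.2, q4.1, q4.2]

theorem norm2_rhs_sub_le (S : FloatResetStep P p K ε z z') (h : p.Admissible P tol) (hn : 1 ≤ n)
    (hε : 0 ≤ ε) (hε1 : ε ≤ 1) (hz : norm2 z ≤ p.Cz) :
    norm2 (-PD.mk S.r₁ S.r₂ 0 0 - resetRhs P p τ z) ≤
      Fintype.card (Idx n m) * (entryConst n m * (p.CDF * p.Cz) * ε) := by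
  have hCz := h.Cz_pos
  have hlip := h.lipschitz_le_CDF hn
  have hQ0 := norm_nonneg P.Q
  have hA0 := normF_nonneg P.A
  have hω := h.ω_pos
  have hzk : ∀ k, |z k| ≤ p.Cz := fun k => (abs_le_norm2 z k).trans hz
  -- The common bound on the summands is `T = CDF Cz`: `CDF` dominates `ω` and all matrix entries,
  -- and `Cz` dominates `z`, `b` and `c`.
  have hbig : p.Cz ≤ p.CDF * p.Cz := le_mul_of_one_le_left hCz.le (by linarith)
  have hprod : ∀ a k, |a| ≤ p.CDF → |a| * |z k| ≤ p.CDF * p.Cz := fun a k ha =>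
    mul_le_mul ha (hzk k) (abs_nonneg _) h.CDF_pos.le
  have hQ : ∀ i j, |P.Q i j| ≤ p.CDF := fun i j =>
    (abs_entry_le_l2_opNorm P.Q i j).trans (by linarith)
  have hA : ∀ i j, |P.A i j| ≤ p.CDF := fun i j =>
    (abs_entry_le_normF P.A i j).trans (by linarith)
  have hω' : ∀ k, |p.ω * z k| ≤ p.CDF * p.Cz := fun k => by
    rw [abs_mul]
    exact hprod _ k (by rw [abs_of_pos hω]; linarith)
  have h0 : 0 ≤ entryConst n m * (p.CDF * p.Cz) * ε :=
    mul_nonneg (mul_nonneg (entryConst_nonneg n m) (hCz.le.trans hbig)) hε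
  have h1 := S.abs_r₁_sub_le hε hε1 (fun j k => hprod _ _ (hQ j k)) (fun i j => hprod _ _ (hA i j))
    (fun j => hω' _) (fun j => ((abs_le_norm2 P.c j).trans (h.norm2_c_le hn)).trans hbig)
    (fun j => (hzk _).trans hbig) (fun j => (hzk _).trans hbig)
  have h2 := S.abs_r₂_sub_le hε hε1 (fun i j => hprod _ _ (hA i j)) (fun i => hω' _)
    (fun i => ((abs_le_norm2 P.b i).trans h.norm2_b_le).trans hbig)
  refine norm2_le_card_mul h0 ?_
  rintro (i | i | i | i)
  · refine le_trans (le_of_eq ?_) (h1 i)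
    change |-S.r₁ i - -res1 P p.ω z i| = _
    rw [neg_sub_neg, abs_sub_comm]
  · refine le_trans (le_of_eq ?_) (h2 i)
    change |-S.r₂ i - -res2 P p.ω z i| = _
    rw [neg_sub_neg, abs_sub_comm]
  · simpa [resetRhs, PD.mk] using h0
  · simpa [resetRhs, PD.mk] using h0

theorem norm_G_sub_le (S : FloatResetStep P p K ε z z') (h : p.Admissible P tol) (hn : 1 ≤ n)
    (hε : 0 ≤ ε) (hε1 : ε ≤ 1) (hz : norm2 z ≤ p.Cz) :
    ‖S.G - jac P p z‖ ≤ 4 * Fintype.card (Idx n m) ^ 2 * p.CDF * ε ∧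
      ‖S.G‖ ≤ 4 * Fintype.card (Idx n m) ^ 2 * p.CDF := by
  have hlip := h.lipschitz_le_CDF hn
  have hQ0 := norm_nonneg P.Q
  have hA0 := normF_nonneg P.A
  have hω := h.ω_pos
  have hCz := h.Cz_pos
  have hC := h.CDF_pos
  have hJ : ∀ k l, |jac P p z k l| ≤ p.CDF := fun k l =>
    (abs_jacF_le hω.le hz k l).trans (by linarith)
  have hJ' : ∀ k l, |jacF S.Q S.A p.ω z k l - jac P p z k l| ≤ p.CDF * ε := fun k l =>
    (abs_jacF_sub_le hε S.Q_rounds S.A_rounds p.ω z k l).trans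
      (by rw [mul_comm]; gcongr; linarith)
  have hCε : p.CDF * ε ≤ p.CDF := mul_le_of_le_one_right hC.le hε1
  -- Storing the data contributes `CDF ε`, and the rounded operation on an entry of size at most `2
  -- CDF` contributes `2 CDF ε`.
  have hGJ : ∀ k l, |S.G k l - jac P p z k l| ≤ 3 * p.CDF * ε := by
    intro k l
    have e1 : |jacF S.Q S.A p.ω z k l| ≤ 2 * p.CDF := by
      have h1 := abs_le.1 (hJ k l)
      have h2 := abs_le.1 (hJ' k l)
      exact abs_le.2 ⟨by linarith [h1.1, h2.1], by linarith [h1.2, h2.2]⟩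
    have e2 := (S.G_rounds k l).abs_sub_le.trans (mul_le_mul_of_nonneg_left e1 hε)
    have e3 := abs_sub_le (S.G k l) (jacF S.Q S.A p.ω z k l) (jac P p z k l)
    linarith [hJ' k l]
  have hG : ∀ k l, |S.G k l| ≤ 4 * p.CDF := by
    intro k l
    have h1 := abs_le.1 (hJ k l)
    have h2 := abs_le.1 (hGJ k l)
    exact abs_le.2 ⟨by linarith [h1.1, h2.1], by linarith [h1.2, h2.2]⟩
  have hCε0 : 0 ≤ p.CDF * ε := mul_nonneg hC.le hε
  constructor
  · refine (l2_opNorm_le_of_abs_le (a := 4 * p.CDF * ε) (by linarith) fun k l => ?_).trans_eq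
      (by ring)
    exact (hGJ k l).trans (by linarith)
  · exact (l2_opNorm_le_of_abs_le (by linarith) hG).trans_eq (by ring)

theorem mem_spaceNenv (S : FloatResetStep P p K ε z z') (h : p.Admissible P tol) (hn : 1 ≤ n)
    (hK : 0 ≤ K) (hε : 0 < ε) (hCε : resetConst n m K * ε ≤ p.ν₀ / (4 * p.Cz * p.κDF))
    (hτ : τ ∈ Set.Icc (p.σ * p.τE) p.τA) (hz : z ∈ spaceNhenv P p τ p.ν₂) :
    z' ∈ spaceNenv P p τ p.ν₀ := by
  obtain ⟨hγ1, hnz, hinv, hrhs⟩ := bounds_of_mem_spaceNhenv h hn hτ hz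
  have hreg := isUnit_det_of_norm2_le hinv
  obtain ⟨Δ, hΔ⟩ : ∃ Δ, jac P p z *ᵥ Δ = resetRhs P p τ z :=
    ⟨(jac P p z)⁻¹ *ᵥ resetRhs P p τ z, by
      rw [Matrix.mulVec_mulVec, Matrix.mul_nonsing_inv _ hreg, Matrix.one_mulVec]⟩
  refine ⟨z + Δ, reset_mem_spaceN h hn hτ hz hΔ, ?_⟩
  have hCz := h.one_le_Cz hn
  have hR := h.CDFinv_pos
  have hCDF := h.CDF_pos
  have hCDF1 : 1 ≤ p.CDF := by
    linarith [h.lipschitz_le_CDF hn, norm_nonneg P.Q, normF_nonneg P.A, h.ω_pos]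
  have hR1 : 1 ≤ p.CDFinv := by
    refine le_trans ?_ h.CDFinv_ge
    have h1 : 1 ≤ 1 / p.Cgap := by rw [le_div_iff₀ h.Cgap_pos]; linarith
    have h2 : 1 ≤ 1 / p.ω := by rw [le_div_iff₀ h.ω_pos]; linarith [h.ω_le_one]
    exact one_le_mul_of_one_le_of_one_le h1 (h2.trans (le_max_left _ _))
  have hκ1 : 1 ≤ p.κDF :=
    (one_le_mul_of_one_le_of_one_le hCDF1 hR1).trans h.κDF_ge
  have hν₂ := h.ν₂_pos
  -- Via `(1 + CDFinv CδF) ν₂ ≤ Cν ν₂ ≤ Cgap ≤ 1`. With this, `‖Δ‖` drops out of all relative errors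
  -- below.
  have hsmallν : p.CDFinv * p.CδF * p.ν₂ ≤ 1 := by
    have h1 := mul_le_mul_of_nonneg_right h.CδDFinv_le_Cν hν₂.le
    linarith [h.Cν_mul_ν₂_le_Cgap]
  have hnΔ : norm2 Δ ≤ 1 := (norm2_reset_le h hn hτ hz hΔ).trans hsmallν
  -- The common unit of error: it dominates `ε`, `ε Cz`, `CDFinv CDF ε` and `CDFinv CDF Cz ε`.
  set s := p.κDF * p.Cz * ε with hs
  set N := (Fintype.card (Idx n m) : ℝ) with hN
  set E := entryConst n m with hE
  have hN0 : 0 ≤ N := Nat.cast_nonneg _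
  have hE0 : 0 ≤ E := entryConst_nonneg n m
  have hs0 : 0 < s := by positivity
  have hεs' : ε * p.Cz ≤ s := by
    have := mul_le_mul_of_nonneg_right hκ1 (mul_nonneg hε.le (zero_le_one.trans hCz))
    rw [hs]; linarith
  have hεs : ε ≤ s := (le_mul_of_one_le_right hε.le hCz).trans hεs'
  have hCs : resetConst n m K * s ≤ p.ν₀ / 4 := by
    rw [le_div_iff₀ (by positivity)] at hCε
    rw [hs]
    linarith
  rw [resetConst, ← hN, ← hE] at hCs
  have hν₀ := h.ν₀_le_one
  have hp1 : 0 ≤ N * E * s := by positivity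
  have hp2 : 0 ≤ K * s := by positivity
  have hp3 : 0 ≤ N ^ 2 * s := by positivity
  have hp4 : 0 ≤ N ^ 2 * K * s := by positivity
  have hCs' : 8 * (N * E * s) + 5 * (K * s) + 16 * (N ^ 2 * s) + 16 * (N ^ 2 * K * s) + 3 * s
      ≤ p.ν₀ / 4 := by linarith
  have hε1 : ε ≤ 1 := by linarith
  have hKεs : K * ε ≤ K * s := mul_le_mul_of_nonneg_left hεs hK
  have hRC : p.CDFinv * p.CDF * ε ≤ s := by
    have h1 := mul_le_mul_of_nonneg_right h.κDF_ge hε.le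
    have h2 : p.κDF * ε ≤ s := by
      have := le_mul_of_one_le_right (mul_nonneg h.κDF_pos.le hε.le) hCz
      rw [hs]; linarith
    linarith
  have hRCz : p.CDFinv * (p.CDF * p.Cz) * ε ≤ s := by
    have h1 := mul_le_mul_of_nonneg_right h.κDF_ge (mul_nonneg (zero_le_one.trans hCz) hε.le)
    rw [hs]; linarith
  obtain ⟨hη, hg⟩ := S.norm_G_sub_le h hn hε.le hε1 hnz
  rw [← hN] at hη hg
  have hρ := S.norm2_rhs_sub_le (τ := τ) h hn hε.le hε1 hnz
  rw [← hN, ← hE] at hρ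
  have hcoef : p.CDFinv * (4 * N ^ 2 * p.CDF * ε + K * ε * (4 * N ^ 2 * p.CDF)) ≤
      4 * (N ^ 2 * s) + 4 * (N ^ 2 * K * s) := by
    have h1 := mul_le_mul_of_nonneg_left hRC (by positivity : 0 ≤ 4 * N ^ 2 * (1 + K))
    linarith
  have hcond : K * ε * (4 * N ^ 2 * p.CDF * (2 * p.CDFinv)) ≤ 8 * (N ^ 2 * K * s) := by
    have h1 := mul_le_mul_of_nonneg_left hRC (by positivity : 0 ≤ 8 * (N ^ 2 * K))
    linarith
  have herr := S.Δ_solves.norm2_sub_le hR.le (mul_nonneg hK hε.le) (by linarith) hinv hη hg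
    (by linarith) (by linarith) hΔ hρ
  -- The parts of `resetConst` arise here: `8 N E` from the residual, `16 N² (1 + K)` from the
  -- matrix, and `5 K` from the perturbed right-hand side (`4 K`) and the final solver error (`K`).
  have hu : norm2 (S.Δ - Δ) ≤
      8 * (N * E * s) + 5 * (K * s) + 16 * (N ^ 2 * s) + 16 * (N ^ 2 * K * s) := by
    have t1 := mul_le_mul_of_nonneg_left hRCz (mul_nonneg hN0 hE0)
    have t2 : K * ε * (p.CDFinv * norm2 (resetRhs P p τ z)) ≤ K * ε * 1 :=
      mul_le_mul_of_nonneg_left ((mul_le_mul_of_nonneg_left hrhs hR.le).trans (by linarith))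
        (mul_nonneg hK hε.le)
    have t3 := mul_le_mul hcoef hnΔ (norm2_nonneg _) (by positivity)
    have t4 := mul_le_mul_of_nonneg_left hnΔ (mul_nonneg hK hε.le)
    linarith
  have hsumn : norm2 (z + S.Δ) ≤ p.Cz + 2 := by
    have h1 := norm2_add_le z S.Δ
    have h2 := norm2_add_le Δ (S.Δ - Δ)
    rw [add_sub_cancel] at h2
    linarith
  have hupd : norm2 (z' - (z + S.Δ)) ≤ ε * norm2 (z + S.Δ) :=
    norm2_le_mul_of_abs_le hε.le S.update
  have hfin := norm2_add_le (z' - (z + S.Δ)) (S.Δ - Δ)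
  rw [show z' - (z + S.Δ) + (S.Δ - Δ) = z' - (z + Δ) by abel] at hfin
  -- The last rounding costs `ε (Cz + 2) ≤ 3 s`, the summand `3` of `resetConst`.
  have h1 := mul_le_mul_of_nonneg_left hsumn hε.le
  linarith [h.ν₀_pos]

end FloatResetStep

end Floating

end StableIPM

end

theorem mainTheorem3 (n m : ℕ) (hn : 1 ≤ n) :
    -- floating-point arithmetic; the constant `C` depends only on `n`, `m` and the solver
    (∀ K : ℝ, 0 ≤ K → ∃ C : ℝ, 0 < C ∧
      ∀ (P : StableIPM.BoxQP n m) (tol : ℝ), 0 < tol →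
      ∀ p : StableIPM.Params, p.Admissible P tol →
      ∀ ε : ℝ, 0 < ε → C * ε ≤ p.ν₀ / (4 * p.Cz * p.κDF) →
      ∀ τ : ℝ, τ ∈ Set.Icc (p.σ * p.τE) p.τA →
      ∀ z ∈ StableIPM.spaceNhenv P p τ p.ν₂,
      ∀ z' : StableIPM.PD n m, Nonempty (StableIPM.FloatResetStep P p K ε z z') →
        z' ∈ StableIPM.spaceNenv P p τ p.ν₀) ∧
    -- exact arithmetic
    (∀ (P : StableIPM.BoxQP n m) (tol : ℝ), 0 < tol →
      ∀ p : StableIPM.Params, p.Admissible P tol →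
      ∀ τ : ℝ, τ ∈ Set.Icc (p.σ * p.τE) p.τA →
      ∀ z ∈ StableIPM.spaceNhenv P p τ p.ν₂,
        IsUnit (StableIPM.jac P p z).det ∧
        ∀ Δ : StableIPM.PD n m,
          (StableIPM.jac P p z).mulVec Δ = StableIPM.resetRhs P p τ z →
          z + Δ ∈ StableIPM.spaceN P p τ) := by
  refine ⟨fun K hK => ⟨StableIPM.resetConst n m K, ?_, ?_⟩, ?_⟩
  · have := StableIPM.entryConst_nonneg n m
    unfold StableIPM.resetConst
    positivity
  · rintro P tol - p hp ε hε hCε τ hτ z hz z' ⟨S⟩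
    exact S.mem_spaceNenv hp hn hK hε hCε hτ hz
  · intro P tol _ p hp τ hτ z hz
    obtain ⟨-, -, hinv, -⟩ := StableIPM.bounds_of_mem_spaceNhenv hp hn hτ hz
    exact ⟨StableIPM.isUnit_det_of_norm2_le hinv,
      fun Δ hΔ => StableIPM.reset_mem_spaceN hp hn hτ hz hΔ⟩
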